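/- Let $n,j,k\in\mathbb N$ with $n\ge 1$ and $1\le j<k$. A Young function is a (strictly) increasing convex function $A:[0,\infty)\to[0,\infty)$ with $\lim_{t\to\infty}A(t)/t=\infty$ and $\lim_{t\to0+}A(t)/t=0$; it is a bijection of $[0,\infty)$ and $A^{-1}$ denotes its inverse. For a measurable function $f$ (scalar or vector valued, $|\cdot|$ being the Euclidean norm) on $\mathbb R^n$ or on $(0,\infty)$ with Lebesgue measure, put $$\|f\|_{L^A}=\inf\Big\{\lambda>0:\int A(|f|/\lambda)\,dx\le 1\Big\}\in[0,\infty],\qquad \inf\emptyset=\infty,\quad A(\infty)=\infty .$$ For $f$ on $\mathbb R^n$ and $t>0$ let $f^*(t)=\inf\{s>0:|\{|f|>s\}|\le t\}$ and $f^{**}(t)=\frac1t\int_0^t f^*(s)\,ds$; the norm $\|f^{**}\|_{L^A}$ is taken over $(0,\infty)$. The upper Boyd index of $L^A$ is $\inf_{s>1}\frac{\log h_A(s)}{\log s}$, where $h_A(s)$ is the norm of the dilation operator $f\mapsto f(\cdot/s)$ on $L^A(0,\infty)$. A function $u:\mathbb R^n\to\mathbb R$ is $k$-times weakly differentiable if $u$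 is locally integrable and has locally integrable weak partial derivatives of all orders up to $k$; $\nabla^m u$ is the vector of all weak partial derivatives $\partial_{\alpha_1}\cdots\partial_{\alpha_m}u$, $1\le\alpha_i\le n$. Let $A,B,C$ be Young functions and consider the condition that there is a constant $K$ with $$B^{-1}(t)^{j/k}\,C^{-1}(t)^{1-j/k}\le K\,A^{-1}(t)\qquad\text{for all } t>0. \tag{1}$$ (a) If (1) holds, then there is a constant $K'$ such that $$\|\nabla^j u\|_{L^A}\le K'\,\|(\nabla^k u)^{**}\|_{L^B}^{j/k}\,\|u^{**}\|_{L^C}^{1-j/k}$$ for all $k$-times weakly differentiable functions $u$ on $\mathbb R^n$ for which the right-hand side is not of the indeterminate form $0^{j/k}\cdot\infty^{1-j/k}$. (b) If (1) holds and the upper Boyd indices of $L^B$ and $L^C$ are smaller than $1$, then there is a constant $K'$ such that $$\|\nabla^j u\|_{L^A}\le K'\,\|\nabla^k u\|_{L^B}^{j/k}\,\|u\|_{L^C}^{1-j/k} \tag{2}$$ for all $k$-times weakly differentiable functions $u$ on $\mathbb R^n$ for which the right-hand side is not of the indeterminate form $0^{j/k}\cdot\infty^{1-j/k}$. (c) If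 (1) does not hold, then (2) fails: there is no constant $K'$ for which (2) holds for all $u$ as in (b). -/

import Mathlib

open MeasureTheory Filter Set
open scoped NNReal ENNReal Topology ContDiff

noncomputable section

namespace GNOrlicz

/-! ### Young functions and Orlicz spaces -/

/-- Young functions `A : [0, ∞) → [0, ∞)`: increasing, convex, with `A t / t → ∞` as `t → ∞`
and `A t / t → 0` as `t → 0+`. -/
structure IsYoung (A : ℝ≥0 → ℝ≥0) : Prop where
  strictMono : StrictMono A
  convex : ConvexOn ℝ≥0 univ A
  tendsto_atTop : Tendsto (fun t => A t / t) atTop atTop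
  tendsto_zero : Tendsto (fun t => A t / t) (𝓝[>] 0) (𝓝 0)

theorem IsYoung.bijective {A : ℝ≥0 → ℝ≥0} (hA : IsYoung A) : Function.Bijective A := by
  refine ⟨hA.strictMono.injective, ?_⟩
  have hg : ConvexOn ℝ univ (fun x : ℝ => (A x.toNNReal : ℝ)) := by
    refine ⟨convex_univ, fun x _ y _ a b ha hb hab => ?_⟩
    lift a to ℝ≥0 using ha
    lift b to ℝ≥0 using hb
    have h1 : ((a : ℝ) • x + (b : ℝ) • y).toNNReal ≤ a • x.toNNReal + b • y.toNNReal := by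
      rw [Real.toNNReal_le_iff_le_coe]
      simp only [smul_eq_mul, NNReal.coe_add, NNReal.coe_mul]
      gcongr
      · exact Real.le_coe_toNNReal x
      · exact Real.le_coe_toNNReal y
    have h2 := hA.convex.2 (mem_univ x.toNNReal) (mem_univ y.toNNReal) zero_le zero_le
      (by exact_mod_cast hab)
    exact_mod_cast (hA.strictMono.monotone h1).trans h2
  have hc : Continuous A := by
    have h := (continuousOn_univ.1 (hg.continuousOn isOpen_univ)).comp NNReal.continuous_coe
    simp only [Function.comp_def, Real.toNNReal_coe] at h
    exact NNReal.isEmbedding_coe.continuous_iff.2 h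
  have h0 : A 0 = 0 := by
    have hl : Tendsto (fun t => A t / t * t) (𝓝[>] 0) (𝓝 (0 * 0)) :=
      hA.tendsto_zero.mul (tendsto_id.mono_left nhdsWithin_le_nhds)
    rw [mul_zero] at hl
    refine le_antisymm (ge_of_tendsto hl ?_) zero_le
    filter_upwards [self_mem_nhdsWithin] with t ht
    rw [div_mul_cancel₀ _ (ne_of_gt ht)]
    exact hA.strictMono.monotone zero_le
  intro y
  have htop : Tendsto A atTop atTop := by
    refine tendsto_atTop_mono' _ ?_ hA.tendsto_atTop
    filter_upwards [eventually_ge_atTop 1] with t ht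
    exact div_le_self zero_le ht
  obtain ⟨M, hM⟩ := (htop.eventually_ge_atTop y).exists
  obtain ⟨x, -, hx⟩ := intermediate_value_Icc zero_le hc.continuousOn ⟨by rw [h0]; exact zero_le, hM⟩
  exact ⟨x, hx⟩

/-- The inverse function of `A`. A Young function is a bijection of `[0, ∞)`
(see `IsYoung.bijective`), so this is its two-sided inverse. -/
def inverse (A : ℝ≥0 → ℝ≥0) : ℝ≥0 → ℝ≥0 := Function.invFun A

/-- The extension of `A` to `[0, ∞]` by `A ∞ = ∞`. -/
def extend (A : ℝ≥0 → ℝ≥0) (x : ℝ≥0∞) : ℝ≥0∞ :=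
  if x = ⊤ then ⊤ else (A x.toNNReal : ℝ≥0∞)

/-- The modular `∫ A (f x) dμ(x)` of a `[0, ∞]`-valued function. -/
def modular {α : Type*} [MeasurableSpace α] (A : ℝ≥0 → ℝ≥0) (μ : Measure α)
    (f : α → ℝ≥0∞) : ℝ≥0∞ :=
  ∫⁻ x, extend A (f x) ∂μ

/-- The Luxemburg norm `inf {l > 0 : ∫ A (f / l) dμ ≤ 1}` of a `[0, ∞]`-valued function,
with `inf ∅ = ∞`. For a real or vector valued function apply it to `x ↦ ‖f x‖ₑ`. -/
def luxemburg {α : Type*} [MeasurableSpace α] (A : ℝ≥0 → ℝ≥0) (μ : Measure α)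
    (f : α → ℝ≥0∞) : ℝ≥0∞ :=
  ⨅ (l : ℝ≥0) (_ : 0 < l ∧ modular A μ (fun x => f x / (l : ℝ≥0∞)) ≤ 1), (l : ℝ≥0∞)

/-! ### Rearrangements -/

/-- The non-increasing rearrangement `f* (t) = inf {s ∈ (0, ∞) : μ {f > s} ≤ t}`,
with `inf ∅ = ∞`. -/
def rearr {α : Type*} [MeasurableSpace α] (μ : Measure α) (f : α → ℝ≥0∞) (t : ℝ) : ℝ≥0∞ :=
  ⨅ (s : ℝ≥0) (_ : 0 < s ∧ μ {x | (s : ℝ≥0∞) < f x} ≤ ENNReal.ofReal t), (s : ℝ≥0∞)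

/-- The maximal function of the rearrangement, `f** (t) = (1 / t) ∫₀ᵗ f* (s) ds`, for `t > 0`. -/
def maxRearr {α : Type*} [MeasurableSpace α] (μ : Measure α) (f : α → ℝ≥0∞) (t : ℝ) : ℝ≥0∞ :=
  (∫⁻ s in Ioo 0 t, rearr μ f s) / ENNReal.ofReal t

/-- Lebesgue measure on the half line `(0, ∞)`. -/
abbrev halfLine : Measure ℝ := volume.restrict (Ioi 0)

/-! ### Boyd indices -/

/-- The norm of the dilation operator `f ↦ f (· / s)` on the Orlicz space `L^A (0, ∞)`. -/
def dilationNorm (A : ℝ≥0 → ℝ≥0) (s : ℝ) : ℝ≥0∞ :=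
  ⨆ (f : ℝ → ℝ) (_ : AEMeasurable f halfLine ∧ luxemburg A halfLine (fun t => ‖f t‖ₑ) ≤ 1),
    luxemburg A halfLine (fun t => ‖f (t / s)‖ₑ)

/-- The upper Boyd index `inf_{s > 1} log h (s) / log s` of `L^A`, where `h (s)` is the norm of
the dilation `f ↦ f (· / s)`. For a Young function `1 ≤ h (s) ≤ s` when `s > 1`, so the infimum
is that of a set of numbers in `[0, 1]`. -/
def upperBoydIndex (A : ℝ≥0 → ℝ≥0) : ℝ :=
  ⨅ s : Ioi (1 : ℝ), Real.log (dilationNorm A s).toReal / Real.log s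

/-! ### Weak derivatives -/

/-- `v` is the weak gradient `∇ᵐ u` of order `m` of `u : ℝⁿ → ℝ`: it is locally integrable and its
component with index `(α₁, …, α_m)` is the weak partial derivative `∂_{α₁} ⋯ ∂_{α_m} u`. All these
components together form a vector, measured in the Euclidean norm. -/
def HasWeakGrad {n : ℕ} (m : ℕ) (u : EuclideanSpace ℝ (Fin n) → ℝ)
    (v : EuclideanSpace ℝ (Fin n) → EuclideanSpace ℝ (Fin m → Fin n)) : Prop :=
  LocallyIntegrable v volume ∧
    ∀ φ : EuclideanSpace ℝ (Fin n) → ℝ, ContDiff ℝ ∞ φ → HasCompactSupport φ →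
      ∀ α : Fin m → Fin n,
        ∫ x, u x * iteratedFDeriv ℝ m φ x (fun i => EuclideanSpace.single (α i) (1 : ℝ))
          = (-1) ^ m * ∫ x, v x α * φ x

/-- `u` is `k`-times weakly differentiable on `ℝⁿ`: it is locally integrable and has weak
gradients of all orders up to `k`. -/
def WeaklyDifferentiable {n : ℕ} (k : ℕ) (u : EuclideanSpace ℝ (Fin n) → ℝ) : Prop :=
  LocallyIntegrable u volume ∧ ∀ m ≤ k, ∃ v, HasWeakGrad m u v

/-! ### The condition and the inequalities -/

/-- `B⁻¹(t)^{j/k} C⁻¹(t)^{1-j/k} ≲ A⁻¹(t)` for all `t > 0`. -/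
def InverseCondition (j k : ℕ) (A B C : ℝ≥0 → ℝ≥0) : Prop :=
  ∃ K : ℝ≥0, ∀ t : ℝ≥0, 0 < t →
    inverse B t ^ ((j : ℝ) / k) * inverse C t ^ (1 - (j : ℝ) / k) ≤ K * inverse A t

/-- `‖∇ʲ u‖_{L^A} ≲ ‖(∇ᵏ u)**‖_{L^B}^{j/k} ‖u**‖_{L^C}^{1-j/k}` for all `k`-times weakly
differentiable `u` on `ℝⁿ` whose right-hand side is not the indeterminate `0 · ∞`. -/
def MaximalInequality (n j k : ℕ) (A B C : ℝ≥0 → ℝ≥0) : Prop :=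
  ∃ K : ℝ≥0, ∀ u : EuclideanSpace ℝ (Fin n) → ℝ, WeaklyDifferentiable k u →
    ∀ gj gk, HasWeakGrad j u gj → HasWeakGrad k u gk →
      (luxemburg B halfLine (maxRearr volume fun x => ‖gk x‖ₑ) ≠ 0 ∨
        luxemburg C halfLine (maxRearr volume fun x => ‖u x‖ₑ) ≠ ⊤) →
      luxemburg A volume (fun x => ‖gj x‖ₑ) ≤
        K * (luxemburg B halfLine (maxRearr volume fun x => ‖gk x‖ₑ) ^ ((j : ℝ) / k) *
          luxemburg C halfLine (maxRearr volume fun x => ‖u x‖ₑ) ^ (1 - (j : ℝ) / k))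

/-- `‖∇ʲ u‖_{L^A} ≲ ‖∇ᵏ u‖_{L^B}^{j/k} ‖u‖_{L^C}^{1-j/k}` for all `k`-times weakly
differentiable `u` on `ℝⁿ` whose right-hand side is not the indeterminate `0 · ∞`. -/
def PlainInequality (n j k : ℕ) (A B C : ℝ≥0 → ℝ≥0) : Prop :=
  ∃ K : ℝ≥0, ∀ u : EuclideanSpace ℝ (Fin n) → ℝ, WeaklyDifferentiable k u →
    ∀ gj gk, HasWeakGrad j u gj → HasWeakGrad k u gk →
      (luxemburg B volume (fun x => ‖gk x‖ₑ) ≠ 0 ∨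
        luxemburg C volume (fun x => ‖u x‖ₑ) ≠ ⊤) →
      luxemburg A volume (fun x => ‖gj x‖ₑ) ≤
        K * (luxemburg B volume (fun x => ‖gk x‖ₑ) ^ ((j : ℝ) / k) *
          luxemburg C volume (fun x => ‖u x‖ₑ) ^ (1 - (j : ℝ) / k))

end GNOrlicz

end

/-! Sufficiency rests on a pointwise inequality. Write `k = j + m`, `θ = j / k`, and let `M` be the
uncentered Hardy–Littlewood maximal operator. Then at almost every `x`, for all `h > 0` at once,
|∇ʲu(x)| ≤ c (h⁻ʲ Mu(x) + hᵐ M(∇ᵏu)(x)) (`exists_enorm_weakGrad_le`). For smooth `U` it comes from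
F(s) = ∫ DʲU(x + s y) φ(y) dy with a normalized bump `φ`. Here F(0) is the derivative sought; the
m-th derivative of F is bounded by means of DᵏU; and for s ≥ h integration by parts moves the j
derivatives onto `φ`, so |F(s)| is at most a constant times h⁻ʲ times a mean of |U|. The m-th finite
difference of F at 0 with step h joins the two bounds. Weakly differentiable `u` are mollified;
means of the mollified functions over balls of every radius stay below a multiple of the maximal
function of the original, and Lebesgue differentiation gives the limit.

Choosing h to balance the two terms gives |∇ʲu| ≲ M(∇ᵏu)^θ (Mu)^(1-θ). With t = max(B(M(∇ᵏu)/β),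
C(Mu/γ)), the condition on inverses turns this into A(|∇ʲu|/Λ) ≤ t, where Λ is a constant times β^θ
γ^(1-θ) (`IsYoung.extend_le_add_of_interpolation`). After integration it suffices to bound the
modulars of the two maximal functions. In (a), the weak type estimate with only large values on the
right yields |{Mf > 2s}| ≤ 5ⁿ |{f** > s}|. In (b), an upper Boyd index below 1 means s B(t) ≤ B(a t)
for some 1 < a < s, which makes a Marcinkiewicz-type dyadic sum geometric
(`IsYoung.modular_maximal_le`).

For (c), the inequality is tested on dilates of one bump whose support has measure 1/t. Both sides
scale with the same power of the dilation factor, and what remains is the condition at t. -/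

open MeasureTheory Filter Set
open scoped NNReal ENNReal Topology ContDiff

noncomputable section

namespace GNOrlicz

open Metric

/-! ### The Hardy–Littlewood maximal function -/

/-- The uncentered Hardy–Littlewood maximal function of a `[0, ∞]`-valued function. -/
def maximal {n : ℕ} (f : EuclideanSpace ℝ (Fin n) → ℝ≥0∞) (x : EuclideanSpace ℝ (Fin n)) : ℝ≥0∞ :=
  ⨆ (p : EuclideanSpace ℝ (Fin n) × ℝ) (_ : x ∈ ball p.1 p.2),
    (∫⁻ y in ball p.1 p.2, f y) / volume (ball p.1 p.2)

theorem lt_maximal_iff {n : ℕ} {f : EuclideanSpace ℝ (Fin n) → ℝ≥0∞}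
    {x : EuclideanSpace ℝ (Fin n)} {s : ℝ≥0∞} :
    s < maximal f x ↔ ∃ p : EuclideanSpace ℝ (Fin n) × ℝ, x ∈ ball p.1 p.2 ∧
      s < (∫⁻ y in ball p.1 p.2, f y) / volume (ball p.1 p.2) := by
  simp only [maximal, lt_iSup_iff, exists_prop]

theorem measurable_maximal {n : ℕ} (f : EuclideanSpace ℝ (Fin n) → ℝ≥0∞) :
    Measurable (maximal f) := by
  refine measurable_of_Ioi fun s => IsOpen.measurableSet ?_
  have : maximal f ⁻¹' Ioi s = ⋃ (p : EuclideanSpace ℝ (Fin n) × ℝ)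
      (_ : s < (∫⁻ y in ball p.1 p.2, f y) / volume (ball p.1 p.2)), ball p.1 p.2 := by
    ext x
    simp only [mem_preimage, mem_Ioi, lt_maximal_iff, mem_iUnion, exists_prop]
    exact exists_congr fun p => and_comm
  rw [this]
  exact isOpen_iUnion fun p => isOpen_iUnion fun _ => isOpen_ball

theorem maximal_congr_ae {n : ℕ} {f g : EuclideanSpace ℝ (Fin n) → ℝ≥0∞}
    (h : f =ᵐ[volume] g) : maximal f = maximal g := by
  ext x
  simp only [maximal]
  refine iSup_congr fun p => iSup_congr fun _ => ?_
  rw [lintegral_congr_ae (ae_restrict_of_ae h)]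

theorem setLIntegral_ball_le_maximal {n : ℕ} (f : EuclideanSpace ℝ (Fin n) → ℝ≥0∞)
    {x c : EuclideanSpace ℝ (Fin n)} {r : ℝ} (hx : x ∈ ball c r) :
    ∫⁻ y in ball c r, f y ≤ maximal f x * volume (ball c r) := by
  have hr : 0 < r := pos_of_mem_ball hx
  have h : (∫⁻ y in ball c r, f y) / volume (ball c r) ≤ maximal f x :=
    le_iSup₂_of_le (c, r) hx le_rfl
  rwa [ENNReal.div_le_iff (measure_ball_pos volume c hr).ne' measure_ball_lt_top.ne] at h

/-- The weak type `(1, 1)` estimate for the maximal function. -/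
theorem volume_lt_maximal_le {n : ℕ} (f : EuclideanSpace ℝ (Fin n) → ℝ≥0∞) {s : ℝ≥0∞}
    (hs : s ≠ 0) (hs' : s ≠ ⊤) (hn : 1 ≤ n) :
    volume {x | s < maximal f x} ≤ 5 ^ n * ((∫⁻ x, f x) / s) := by
  by_cases hf : ∫⁻ x, f x = ⊤
  · rw [hf, ENNReal.top_div_of_ne_top hs', ENNReal.mul_top (by simp)]
    exact le_top
  set t : Set (EuclideanSpace ℝ (Fin n) × ℝ) :=
    {p | 0 < p.2 ∧ s < (∫⁻ y in ball p.1 p.2, f y) / volume (ball p.1 p.2)} with ht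
  have hvol : ∀ p ∈ t, volume (ball p.1 p.2) ≤ (∫⁻ y in ball p.1 p.2, f y) / s := by
    rintro p ⟨hp, hps⟩
    rw [ENNReal.le_div_iff_mul_le (Or.inl hs) (Or.inl hs'), mul_comm]
    exact ((ENNReal.lt_div_iff_mul_lt (Or.inl (measure_ball_pos volume _ hp).ne')
      (Or.inl measure_ball_lt_top.ne)).1 hps).le
  -- The Vitali lemma needs bounded radii. A selected ball of radius r has rⁿ V ≤ D, and r ≤ rⁿ once
  -- r > 1; this is where n ≥ 1 enters, all balls having the same volume in dimension 0.
  obtain ⟨R, hR⟩ : ∃ R : ℝ, ∀ p ∈ t, p.2 ≤ R := by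
    set D := (∫⁻ x, f x) / s with hD
    have hDtop : D ≠ ⊤ := ENNReal.div_ne_top hf hs
    set V := volume (ball (0 : EuclideanSpace ℝ (Fin n)) 1) with hV
    have hV0 : V ≠ 0 := (measure_ball_pos volume _ one_pos).ne'
    refine ⟨1 + (D / V).toReal, fun p hp => ?_⟩
    by_cases h1 : p.2 ≤ 1
    · exact h1.trans (le_add_of_nonneg_right ENNReal.toReal_nonneg)
    push Not at h1
    have h2 : ENNReal.ofReal (p.2 ^ n) * V ≤ D := by
      have h3 := (hvol p hp).trans (ENNReal.div_le_div_right (setLIntegral_le_lintegral _ _) s)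
      rw [Measure.addHaar_ball_of_pos _ _ hp.1] at h3
      simpa using h3
    rw [← ENNReal.le_div_iff_mul_le (Or.inl hV0) (Or.inl measure_ball_lt_top.ne)] at h2
    have h4 := ENNReal.toReal_mono (ENNReal.div_ne_top hDtop hV0) h2
    rw [ENNReal.toReal_ofReal (by have := hp.1; positivity)] at h4
    have h5 : p.2 ≤ p.2 ^ n := le_self_pow₀ h1.le (by omega)
    linarith
  obtain ⟨w, hwt, hdisj, hcov⟩ := Vitali.exists_disjoint_subfamily_covering_enlargement_closedBall
    t Prod.fst Prod.snd R hR 5 (by norm_num)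
  have hdisj' : w.PairwiseDisjoint fun p => ball p.1 p.2 :=
    hdisj.mono fun p => ball_subset_closedBall
  have hcount : w.Countable := hdisj'.countable_of_isOpen (fun _ _ => isOpen_ball)
    fun p hp => nonempty_ball.2 (hwt hp).1
  have hsub : {x | s < maximal f x} ⊆ ⋃ p ∈ w, closedBall p.1 (5 * p.2) := by
    intro x hx
    obtain ⟨p, hxp, hp⟩ := lt_maximal_iff.1 hx
    obtain ⟨q, hq, hpq⟩ := hcov p ⟨pos_of_mem_ball hxp, hp⟩
    exact mem_biUnion hq (hpq (ball_subset_closedBall hxp))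
  have := hcount.to_subtype
  calc volume {x | s < maximal f x} ≤ volume (⋃ p ∈ w, closedBall p.1 (5 * p.2)) :=
        measure_mono hsub
    _ ≤ ∑' p : w, volume (closedBall p.1.1 (5 * p.1.2)) := measure_biUnion_le _ hcount _
    _ ≤ ∑' p : w, 5 ^ n * ((∫⁻ y in ball p.1.1 p.1.2, f y) / s) := by
        refine ENNReal.tsum_le_tsum fun p => ?_
        have hp := (hwt p.2).1
        calc volume (closedBall p.1.1 (5 * p.1.2)) = 5 ^ n * volume (ball p.1.1 p.1.2) := by
              rw [Measure.addHaar_closedBall _ _ (by positivity),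
                Measure.addHaar_ball_of_pos _ _ hp, mul_pow, ENNReal.ofReal_mul (by positivity),
                ENNReal.ofReal_pow (by norm_num)]
              simp [mul_assoc]
          _ ≤ _ := by
              gcongr
              exact hvol p.1 (hwt p.2)
    _ = 5 ^ n * ((∑' p : w, ∫⁻ y in ball p.1.1 p.1.2, f y) / s) := by
        simp only [div_eq_mul_inv, ENNReal.tsum_mul_left, ENNReal.tsum_mul_right]
    _ ≤ 5 ^ n * ((∫⁻ x, f x) / s) := by
        gcongr
        rw [← lintegral_biUnion hcount (fun _ _ => measurableSet_ball) hdisj']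
        exact setLIntegral_le_lintegral _ _

/-- The weak type estimate, where only the large values of the function enter. -/
theorem volume_two_mul_lt_maximal_le {n : ℕ} {f : EuclideanSpace ℝ (Fin n) → ℝ≥0∞}
    (hf : AEMeasurable f) {s : ℝ≥0∞} (hs : s ≠ 0) (hs' : s ≠ ⊤) (hn : 1 ≤ n) :
    volume {x | 2 * s < maximal f x} ≤ 5 ^ n * ((∫⁻ x in {x | s < f x}, f x) / s) := by
  have hset : NullMeasurableSet {x | s < f x} := nullMeasurableSet_lt aemeasurable_const hf
  rw [← lintegral_indicator₀ hset]
  -- The truncation of `f` to {f > s} differs from `f` by at most s, so a ball on which the mean of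
  -- `f` exceeds 2s is one on which the mean of the truncation exceeds s.
  refine le_trans (measure_mono fun x hx => ?_) (volume_lt_maximal_le _ hs hs' hn)
  obtain ⟨p, hxp, hp⟩ := lt_maximal_iff.1 hx
  refine lt_maximal_iff.2 ⟨p, hxp, ?_⟩
  have hr : 0 < p.2 := pos_of_mem_ball hxp
  by_contra! hcon
  refine absurd hp (not_lt.2 ?_)
  rw [ENNReal.div_le_iff (measure_ball_pos volume _ hr).ne' measure_ball_lt_top.ne] at hcon ⊢
  calc ∫⁻ y in ball p.1 p.2, f y
      ≤ ∫⁻ y in ball p.1 p.2, ({x | s < f x}.indicator f y + s) := by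
        refine lintegral_mono fun y => ?_
        by_cases hy : s < f y
        · rw [indicator_of_mem (show y ∈ {x | s < f x} from hy)]
          exact le_self_add
        · exact (not_lt.1 hy).trans le_add_self
    _ = (∫⁻ y in ball p.1 p.2, {x | s < f x}.indicator f y) + s * volume (ball p.1 p.2) := by
        rw [lintegral_add_right _ measurable_const, setLIntegral_const]
    _ ≤ s * volume (ball p.1 p.2) + s * volume (ball p.1 p.2) := by gcongr
    _ = 2 * s * volume (ball p.1 p.2) := by ring

/-! ### Young functions, modulars and Luxemburg norms -/

namespace IsYoung

variable {A : ℝ≥0 → ℝ≥0}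

theorem map_inverse (hA : IsYoung A) (t : ℝ≥0) : A (inverse A t) = t :=
  Function.rightInverse_invFun hA.bijective.2 t

theorem map_zero (hA : IsYoung A) : A 0 = 0 := by
  obtain ⟨t, ht⟩ := hA.bijective.2 0
  exact le_antisymm ((hA.strictMono.monotone zero_le).trans ht.le) zero_le

theorem map_pos (hA : IsYoung A) {t : ℝ≥0} (ht : 0 < t) : 0 < A t :=
  hA.map_zero ▸ hA.strictMono ht

theorem inverse_pos (hA : IsYoung A) {t : ℝ≥0} (ht : 0 < t) : 0 < inverse A t := by
  rw [← hA.strictMono.lt_iff_lt, hA.map_inverse, hA.map_zero]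
  exact ht

theorem map_mul_le (hA : IsYoung A) {c : ℝ≥0} (hc : c ≤ 1) (t : ℝ≥0) : A (c * t) ≤ c * A t := by
  have h := hA.convex.2 (mem_univ t) (mem_univ 0) zero_le zero_le
    (add_tsub_cancel_of_le hc)
  simpa [hA.map_zero] using h

theorem map_div_le (hA : IsYoung A) {c : ℝ≥0} (hc : 1 ≤ c) (t : ℝ≥0) : A (t / c) ≤ A t / c := by
  have h := hA.map_mul_le (c := c⁻¹) (inv_le_one_of_one_le₀ hc) t
  rwa [inv_mul_eq_div, inv_mul_eq_div] at h

theorem inverse_mul_le (hA : IsYoung A) {c : ℝ≥0} (hc : 1 ≤ c) (t : ℝ≥0) :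
    inverse A (c * t) ≤ c * inverse A t := by
  have hc0 : c ≠ 0 := (zero_lt_one.trans_le hc).ne'
  rw [← hA.strictMono.le_iff_le, hA.map_inverse]
  have h := hA.map_div_le hc (c * inverse A t)
  rw [mul_div_cancel_left₀ _ hc0, hA.map_inverse, le_div_iff₀ (zero_lt_one.trans_le hc)] at h
  rwa [mul_comm]

end IsYoung

@[simp]
theorem extend_coe (A : ℝ≥0 → ℝ≥0) (t : ℝ≥0) : extend A t = A t := by simp [extend]

@[simp]
theorem extend_top (A : ℝ≥0 → ℝ≥0) : extend A ⊤ = ⊤ := by simp [extend]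

theorem IsYoung.extend_zero {A : ℝ≥0 → ℝ≥0} (hA : IsYoung A) : extend A 0 = 0 := by
  simpa [hA.map_zero] using extend_coe A 0

theorem IsYoung.extend_mono {A : ℝ≥0 → ℝ≥0} (hA : IsYoung A) : Monotone (extend A) := by
  intro x y hxy
  induction y with
  | top => simp
  | coe y =>
    lift x to ℝ≥0 using ne_top_of_le_ne_top ENNReal.coe_ne_top hxy
    simpa using hA.strictMono.monotone (by exact_mod_cast hxy)

theorem IsYoung.measurable_extend {A : ℝ≥0 → ℝ≥0} (hA : IsYoung A) : Measurable (extend A) :=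
  hA.extend_mono.measurable

theorem IsYoung.lt_extend_iff {A : ℝ≥0 → ℝ≥0} (hA : IsYoung A) {r : ℝ≥0} {x : ℝ≥0∞} :
    (r : ℝ≥0∞) < extend A x ↔ (inverse A r : ℝ≥0∞) < x := by
  induction x with
  | top => simp
  | coe x =>
    rw [extend_coe, ENNReal.coe_lt_coe, ENNReal.coe_lt_coe,
      ← hA.strictMono.lt_iff_lt (a := inverse A r), hA.map_inverse]

theorem IsYoung.extend_div_le {A : ℝ≥0 → ℝ≥0} (hA : IsYoung A) {c : ℝ≥0} (hc : 1 ≤ c)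
    (x : ℝ≥0∞) : extend A (x / c) ≤ extend A x / c := by
  have hc0 : c ≠ 0 := (zero_lt_one.trans_le hc).ne'
  induction x with
  | top => simp [ENNReal.top_div_of_ne_top]
  | coe x =>
    rw [← ENNReal.coe_div hc0, extend_coe, extend_coe, ← ENNReal.coe_div hc0]
    exact_mod_cast hA.map_div_le hc x

theorem IsYoung.extend_eq_zero {A : ℝ≥0 → ℝ≥0} (hA : IsYoung A) {x : ℝ≥0∞}
    (h : extend A x = 0) : x = 0 := by
  induction x with
  | top => simp at h
  | coe x =>
    by_contra hx
    have : 0 < x := pos_iff_ne_zero.2 (by simpa using hx)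
    simp [(hA.map_pos this).ne'] at h

section Luxemburg

variable {α : Type*} [MeasurableSpace α] {A : ℝ≥0 → ℝ≥0} {μ : Measure α} {f g : α → ℝ≥0∞}

theorem luxemburg_le {l : ℝ≥0} (hl : 0 < l)
    (h : modular A μ (fun x => f x / (l : ℝ≥0∞)) ≤ 1) : luxemburg A μ f ≤ l :=
  iInf₂_le l ⟨hl, h⟩

/-- The strict inequality provides an admissible constant below `l`, so attainment of the infimum
never has to be discussed. -/
theorem IsYoung.modular_le_one_of_luxemburg_lt (hA : IsYoung A) {l : ℝ≥0}
    (h : luxemburg A μ f < l) : modular A μ (fun x => f x / (l : ℝ≥0∞)) ≤ 1 := by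
  simp only [luxemburg, iInf_lt_iff] at h
  obtain ⟨l', ⟨-, h1⟩, h2⟩ := h
  exact (lintegral_mono fun x => hA.extend_mono (ENNReal.div_le_div_left h2.le _)).trans h1

/-- By convexity A(x / D) ≤ A(x) / D for D ≥ 1: a constant in a modular estimate costs only the same
constant in the norm. -/
theorem IsYoung.luxemburg_le_of_modular_le (hA : IsYoung A) {l D : ℝ≥0} (hl : 0 < l)
    (hD : 1 ≤ D) (h : modular A μ (fun x => f x / (l : ℝ≥0∞)) ≤ D) :
    luxemburg A μ f ≤ (D * l : ℝ≥0) := by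
  have hD0 : 0 < D := zero_lt_one.trans_le hD
  refine luxemburg_le (by positivity) ?_
  calc modular A μ (fun x => f x / ((D * l : ℝ≥0) : ℝ≥0∞))
      ≤ ∫⁻ x, extend A (f x / l) / D ∂μ := by
        refine lintegral_mono fun x => ?_
        have : f x / ((D * l : ℝ≥0) : ℝ≥0∞) = f x / l / D := by
          rw [mul_comm, ENNReal.coe_mul, div_eq_mul_inv, ENNReal.mul_inv
            (Or.inl (by simpa using hl.ne')) (Or.inl ENNReal.coe_ne_top), ← mul_assoc]
          rfl
        simp only [this]
        exact hA.extend_div_le hD _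
    _ = modular A μ (fun x => f x / (l : ℝ≥0∞)) / D := by
        simp only [div_eq_mul_inv]
        rw [lintegral_mul_const' _ _ (by simp [hD0.ne'])]
        rfl
    _ ≤ D / D := by gcongr
    _ = 1 := ENNReal.div_self (by simpa using hD0.ne') ENNReal.coe_ne_top

theorem IsYoung.luxemburg_eq_zero_of_ae_eq_zero (hA : IsYoung A) (h : f =ᵐ[μ] 0) :
    luxemburg A μ f = 0 := by
  refine le_antisymm (le_of_forall_gt fun c hc => ?_) zero_le
  obtain ⟨l, hl0, hlc⟩ := ENNReal.lt_iff_exists_nnreal_btwn.1 hc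
  refine lt_of_le_of_lt (luxemburg_le (by exact_mod_cast hl0) ?_) hlc
  have : modular A μ (fun x => f x / (l : ℝ≥0∞)) = ∫⁻ x, 0 ∂μ := by
    refine lintegral_congr_ae ?_
    filter_upwards [h] with x hx
    simp [hx, hA.extend_zero]
  simp [this]

end Luxemburg

/-! ### Comparison of distribution functions -/

section Distribution

variable {α β : Type*} [MeasurableSpace α] [MeasurableSpace β] {μ : Measure α} {ν : Measure β}

theorem lintegral_min_eq_lintegral_meas_lt {F : α → ℝ≥0∞} (hF : AEMeasurable F μ) (N : ℕ) :
    ∫⁻ x, min (F x) N ∂μ = ∫⁻ t in Ioi (0 : ℝ), μ {x | ENNReal.ofReal t < min (F x) N} := by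
  have hfin : ∀ x, min (F x) N ≠ ⊤ := fun x =>
    ne_top_of_le_ne_top (ENNReal.natCast_ne_top N) (min_le_right _ _)
  have h := lintegral_eq_lintegral_meas_lt (f := fun x => (min (F x) N).toReal) μ
    (Eventually.of_forall fun x => ENNReal.toReal_nonneg)
    (hF.min aemeasurable_const).ennreal_toReal
  simp only [ENNReal.ofReal_toReal (hfin _)] at h
  rw [h]
  refine setLIntegral_congr_fun measurableSet_Ioi fun t ht => ?_
  congr 1
  ext x
  exact (ENNReal.ofReal_lt_iff_lt_toReal (le_of_lt ht) (hfin x)).symm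

/-- Layer-cake formula on both sides. Truncation at height N keeps the functions finite; monotone
convergence removes it. -/
theorem lintegral_le_of_meas_lt_le {F : α → ℝ≥0∞} {G : β → ℝ≥0∞} (hF : AEMeasurable F μ)
    (hG : AEMeasurable G ν) {c : ℝ≥0∞} (hc : c ≠ ⊤)
    (h : ∀ r : ℝ≥0, 0 < r → μ {x | (r : ℝ≥0∞) < F x} ≤ c * ν {y | (r : ℝ≥0∞) < G y}) :
    ∫⁻ x, F x ∂μ ≤ c * ∫⁻ y, G y ∂ν := by
  have hsup : ∀ x, F x = ⨆ N : ℕ, min (F x) N := fun x => by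
    rw [← inf_iSup_eq, ENNReal.iSup_natCast, inf_top_eq]
  have hmono : ∀ x, Monotone fun N : ℕ => min (F x) N := fun x a b hab =>
    min_le_min_left _ (by exact_mod_cast hab)
  rw [lintegral_congr hsup, lintegral_iSup' (fun N => hF.min aemeasurable_const)
    (Eventually.of_forall hmono)]
  refine iSup_le fun N => ?_
  calc ∫⁻ x, min (F x) N ∂μ
      = ∫⁻ t in Ioi (0 : ℝ), μ {x | ENNReal.ofReal t < min (F x) N} :=
        lintegral_min_eq_lintegral_meas_lt hF N
    _ ≤ ∫⁻ t in Ioi (0 : ℝ), c * ν {y | ENNReal.ofReal t < min (G y) N} := by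
        refine setLIntegral_mono' measurableSet_Ioi fun t ht => ?_
        by_cases htN : ENNReal.ofReal t < N
        · simp only [lt_min_iff, htN, and_true]
          exact h t.toNNReal (Real.toNNReal_pos.2 ht)
        · simp [htN]
    _ = c * ∫⁻ y, min (G y) N ∂ν := by
        rw [lintegral_const_mul' _ _ hc, lintegral_min_eq_lintegral_meas_lt hG N]
    _ ≤ c * ∫⁻ y, G y ∂ν := by
        gcongr
        exact min_le_left _ _

end Distribution

/-! ### The modular of the maximal function and the rearrangement -/

section Rearr

variable {α : Type*} [MeasurableSpace α] {μ : Measure α} {f : α → ℝ≥0∞}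

theorem rearr_antitone : Antitone (rearr μ f) := by
  intro a b hab
  exact le_iInf₂ fun s hs => iInf₂_le s ⟨hs.1, hs.2.trans (ENNReal.ofReal_le_ofReal hab)⟩

theorem measurable_maxRearr : Measurable (maxRearr μ f) := by
  refine Measurable.div (Monotone.measurable fun a b hab => ?_) ENNReal.measurable_ofReal
  exact lintegral_mono_set (Ioo_subset_Ioo_right hab)

/-- Continuity from below of the measure: the set {f > r + 1/(i+1)} still has measure above t for
some i, and then f*(t) ≥ r + 1/(i+1), which gives the strict inequality. -/
theorem lt_rearr {t : ℝ} {r : ℝ≥0} (h : ENNReal.ofReal t < μ {x | (r : ℝ≥0∞) < f x}) :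
    (r : ℝ≥0∞) < rearr μ f t := by
  have hU : {x | (r : ℝ≥0∞) < f x} =
      ⋃ i : ℕ, {x | ((r + 1 / ((i : ℝ≥0) + 1) : ℝ≥0) : ℝ≥0∞) < f x} := by
    ext x
    simp only [mem_ofPred_eq, mem_iUnion]
    refine ⟨fun hx => ?_, fun ⟨i, hi⟩ => lt_of_le_of_lt (by exact_mod_cast le_self_add) hi⟩
    obtain ⟨q, hq, hqx⟩ := ENNReal.lt_iff_exists_nnreal_btwn.1 hx
    have hq' : r < q := by exact_mod_cast hq
    obtain ⟨i, hi⟩ := exists_nat_one_div_lt (tsub_pos_of_lt hq')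
    refine ⟨i, lt_of_le_of_lt ?_ hqx⟩
    have := add_le_add_right hi.le r
    rw [add_tsub_cancel_of_le hq'.le] at this
    exact_mod_cast this
  have hmono : Monotone fun i : ℕ => {x | ((r + 1 / ((i : ℝ≥0) + 1) : ℝ≥0) : ℝ≥0∞) < f x} := by
    intro a b hab x hx
    refine lt_of_le_of_lt ?_ (mem_ofPred_eq ▸ hx)
    gcongr
  rw [hU, hmono.measure_iUnion, lt_iSup_iff] at h
  obtain ⟨i, hi⟩ := h
  have hlt : r < r + 1 / ((i : ℝ≥0) + 1) := lt_add_of_pos_right _ (by positivity)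
  refine lt_of_lt_of_le (ENNReal.coe_lt_coe.2 hlt) (le_iInf₂ fun s hs => ?_)
  by_contra! hcon
  exact absurd (hi.trans_le ((measure_mono fun x hx => lt_trans hcon hx).trans hs.2)) (lt_irrefl _)

/-- If {f > s} had measure above t, then f* would exceed some q > s on (0, t), contradicting f**(t)
≤ s. So {f > s} has measure at most t, and the integral of f over it is at most that of f* over (0,
t): the part of {f > s} where f > r has measure at most w = min(t, |{f > r}|), while f* > r on (0,
w). -/
theorem setLIntegral_lt_le_of_maxRearr_le (hf : AEMeasurable f μ) {t : ℝ} (ht : 0 < t) {s : ℝ≥0}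
    (h : maxRearr μ f t ≤ s) : ∫⁻ x in {x | (s : ℝ≥0∞) < f x}, f x ∂μ ≤ s * ENNReal.ofReal t := by
  have ht0 : ENNReal.ofReal t ≠ 0 := (ENNReal.ofReal_pos.2 ht).ne'
  have hint : ∫⁻ τ in Ioo 0 t, rearr μ f τ ≤ s * ENNReal.ofReal t := by
    rwa [maxRearr, ENNReal.div_le_iff ht0 ENNReal.ofReal_ne_top] at h
  have hvol : μ {x | (s : ℝ≥0∞) < f x} ≤ ENNReal.ofReal t := by
    by_contra! hcon
    obtain ⟨q, hq, hqr⟩ := ENNReal.lt_iff_exists_nnreal_btwn.1 (lt_rearr hcon)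
    have h1 : q * ENNReal.ofReal t ≤ ∫⁻ τ in Ioo 0 t, rearr μ f τ := by
      calc q * ENNReal.ofReal t = ∫⁻ τ in Ioo 0 t, (q : ℝ≥0∞) := by simp
        _ ≤ _ := setLIntegral_mono' measurableSet_Ioo fun τ hτ =>
          hqr.le.trans (rearr_antitone hτ.2.le)
    have h2 := h1.trans hint
    rw [ENNReal.mul_le_mul_iff_left ht0 ENNReal.ofReal_ne_top] at h2
    exact absurd hq (not_lt.2 h2)
  refine le_trans ?_ hint
  have hset : NullMeasurableSet {x | (s : ℝ≥0∞) < f x} μ :=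
    nullMeasurableSet_lt aemeasurable_const hf
  rw [← one_mul (∫⁻ τ in Ioo 0 t, rearr μ f τ), ← lintegral_indicator₀ hset]
  refine lintegral_le_of_meas_lt_le (hf.indicator₀ hset)
    rearr_antitone.measurable.aemeasurable ENNReal.one_ne_top fun r hr => ?_
  rw [one_mul, Measure.restrict_apply
    (measurableSet_lt measurable_const rearr_antitone.measurable)]
  set w := min (ENNReal.ofReal t) (μ {x | (r : ℝ≥0∞) < f x}) with hw
  have hwt : w ≠ ⊤ := ne_top_of_le_ne_top ENNReal.ofReal_ne_top (min_le_left _ _)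
  calc μ {x | (r : ℝ≥0∞) < {x | (s : ℝ≥0∞) < f x}.indicator f x} ≤ w := by
        refine le_min (le_trans (measure_mono fun x hx => ?_) hvol) (measure_mono fun x hx => ?_)
        · by_contra hcon
          rw [mem_ofPred_eq, indicator_of_notMem hcon] at hx
          exact not_lt_zero hx
        · rw [mem_ofPred_eq] at hx ⊢
          exact lt_of_lt_of_le hx (indicator_le_self _ _ _)
    _ = volume (Ioo 0 w.toReal) := by
        rw [Real.volume_Ioo, sub_zero, ENNReal.ofReal_toReal hwt]
    _ ≤ _ := by
        refine measure_mono fun τ hτ => ?_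
        have h1 : ENNReal.ofReal τ < w := (ENNReal.ofReal_lt_iff_lt_toReal hτ.1.le hwt).2 hτ.2
        refine ⟨lt_rearr (h1.trans_le (min_le_right _ _)), hτ.1, ?_⟩
        exact (ENNReal.ofReal_lt_ofReal_iff ht).1 (h1.trans_le (min_le_left _ _))

end Rearr

/-- A weak form of the pointwise bound of (Mf)* by f**, which suffices for modulars because it
compares distribution functions. -/
theorem volume_two_mul_lt_maximal_le_maxRearr {n : ℕ} (hn : 1 ≤ n)
    {f : EuclideanSpace ℝ (Fin n) → ℝ≥0∞} (hf : AEMeasurable f) {s : ℝ≥0} (hs : 0 < s) :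
    volume {x | 2 * (s : ℝ≥0∞) < maximal f x} ≤
      5 ^ n * halfLine {t | (s : ℝ≥0∞) < maxRearr volume f t} := by
  have hs0 : (s : ℝ≥0∞) ≠ 0 := by simpa using hs.ne'
  rw [Measure.restrict_apply (measurableSet_lt measurable_const measurable_maxRearr)]
  set T := volume ({t | (s : ℝ≥0∞) < maxRearr volume f t} ∩ Ioi 0) with hT
  have h5 : (5 : ℝ≥0∞) ^ n ≠ 0 := by positivity
  have h5' : (5 : ℝ≥0∞) ^ n ≠ ⊤ := by simp
  rw [← ENNReal.div_le_iff' h5 h5']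
  refine le_of_forall_gt fun c hc => ?_
  obtain ⟨t, htT, htc⟩ := ENNReal.lt_iff_exists_nnreal_btwn.1 hc
  refine lt_of_le_of_lt ?_ htc
  -- Otherwise {f** > s} would contain (0, t), although its measure is less than t. At such a τ the
  -- integral of f over {f > s} is at most s τ, which is what the weak type estimate needs.
  obtain ⟨τ, hτ0, hτt, hτs⟩ : ∃ τ : ℝ, 0 < τ ∧ τ < t ∧ maxRearr volume f τ ≤ s := by
    by_contra! hcon
    refine absurd htT (not_lt.2 ?_)
    calc (t : ℝ≥0∞) = volume (Ioo (0 : ℝ) t) := by simp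
      _ ≤ T := measure_mono fun τ hτ => ⟨hcon τ hτ.1 hτ.2, hτ.1⟩
  rw [ENNReal.div_le_iff' h5 h5']
  refine (volume_two_mul_lt_maximal_le hf hs0 ENNReal.coe_ne_top hn).trans ?_
  gcongr
  refine ENNReal.div_le_of_le_mul' ((setLIntegral_lt_le_of_maxRearr_le hf hτ0 hτs).trans ?_)
  gcongr
  rw [ENNReal.ofReal_le_iff_le_toReal ENNReal.coe_ne_top]
  exact hτt.le

theorem IsYoung.modular_maximal_le_modular_maxRearr {B : ℝ≥0 → ℝ≥0} (hB : IsYoung B) {n : ℕ}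
    (hn : 1 ≤ n) {f : EuclideanSpace ℝ (Fin n) → ℝ≥0∞} (hf : AEMeasurable f) {l : ℝ≥0}
    (hl : 0 < l) :
    modular B volume (fun x => maximal f x / ((2 * l : ℝ≥0) : ℝ≥0∞)) ≤
      5 ^ n * modular B halfLine (fun t => maxRearr volume f t / (l : ℝ≥0∞)) := by
  have hl0 : (l : ℝ≥0∞) ≠ 0 := by simpa using hl.ne'
  refine lintegral_le_of_meas_lt_le
    (hB.measurable_extend.comp ((measurable_maximal f).div_const _)).aemeasurable
    (hB.measurable_extend.comp (measurable_maxRearr.div_const _)).aemeasurable (by simp)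
    fun r hr => ?_
  have h := volume_two_mul_lt_maximal_le_maxRearr hn hf (mul_pos hl (hB.inverse_pos hr))
  convert h using 3
  · ext x
    refine hB.lt_extend_iff.trans ?_
    rw [ENNReal.lt_div_iff_mul_lt
      (Or.inl (by simpa using hl.ne')) (Or.inl ENNReal.coe_ne_top)]
    push_cast
    rw [show (inverse B r : ℝ≥0∞) * (2 * l) = 2 * (l * inverse B r) by ring]
  · ext t
    refine hB.lt_extend_iff.trans ?_
    rw [mem_ofPred_eq, ENNReal.lt_div_iff_mul_lt
      (Or.inl hl0) (Or.inl ENNReal.coe_ne_top), ENNReal.coe_mul, mul_comm]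

/-! ### The Boyd index and the modular of the maximal function -/

theorem lintegral_halfLine_comp_div (f : ℝ → ℝ≥0∞) {s : ℝ} (hs : 0 < s) :
    ∫⁻ t, f (t / s) ∂halfLine = ENNReal.ofReal s * ∫⁻ t, f t ∂halfLine := by
  let e : ℝ ≃ᵐ ℝ := (Homeomorph.mulRight₀ s⁻¹ (inv_ne_zero hs.ne')).toMeasurableEquiv
  have he : ∀ t, e t = t / s := fun t => rfl
  rw [← lintegral_indicator measurableSet_Ioi, ← lintegral_indicator measurableSet_Ioi]
  have hmap : Measure.map e volume = ENNReal.ofReal s • (volume : Measure ℝ) := by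
    have := Real.map_volume_mul_right (inv_ne_zero hs.ne')
    rw [inv_inv, abs_of_pos hs] at this
    exact this
  calc ∫⁻ t, (Ioi 0).indicator (fun t => f (t / s)) t
      = ∫⁻ t, (Ioi 0).indicator f (e t) := by
        refine lintegral_congr fun t => ?_
        by_cases ht : 0 < t
        · rw [indicator_of_mem (mem_Ioi.2 ht), indicator_of_mem (mem_Ioi.2 (by rw [he]; positivity)),
            he]
        · rw [indicator_of_notMem (by simpa using ht), indicator_of_notMem]
          rw [he, mem_Ioi, not_lt]
          exact div_nonpos_of_nonpos_of_nonneg (not_lt.1 ht) hs.le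
    _ = ENNReal.ofReal s * ∫⁻ t, (Ioi 0).indicator f t := by
        rw [← lintegral_map_equiv _ e, hmap, lintegral_smul_measure, smul_eq_mul]

/-- Dilation multiplies the modular by s, hence the norm by at most s. Finiteness is what matters
later: `toReal` would send an infinite norm to 0 and falsify the index. -/
theorem IsYoung.dilationNorm_le {B : ℝ≥0 → ℝ≥0} (hB : IsYoung B) {s : ℝ≥0} (hs : 1 < s) :
    dilationNorm B s ≤ s := by
  have hs0 : 0 < s := zero_lt_one.trans hs
  refine iSup₂_le fun f hf => ?_
  refine le_of_forall_gt fun c hc => ?_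
  obtain ⟨q, hsq, hqc⟩ := ENNReal.lt_iff_exists_nnreal_btwn.1 hc
  refine lt_of_le_of_lt ?_ hqc
  have hsq' : s < q := by exact_mod_cast hsq
  have hqs : 1 < q / s := (one_lt_div hs0).2 hsq'
  have h1 := hB.modular_le_one_of_luxemburg_lt (l := q / s) (hf.2.trans_lt (by exact_mod_cast hqs))
  have h2 := hB.luxemburg_le_of_modular_le (μ := halfLine)
    (f := fun t => ‖f (t / s)‖ₑ) (l := q / s) (D := s) (zero_lt_one.trans hqs) hs.le ?_
  · rwa [mul_div_cancel₀ _ hs0.ne'] at h2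
  · have h3 := lintegral_halfLine_comp_div (fun t => extend B (‖f t‖ₑ / ((q / s : ℝ≥0) : ℝ≥0∞)))
      (s := s) (by exact_mod_cast hs0)
    rw [modular, h3, ENNReal.ofReal_coe_nnreal]
    calc _ ≤ (s : ℝ≥0∞) * 1 := by gcongr; exact h1
      _ = s := mul_one _

/-- An index below 1 gives some s > 1 with dilation norm less than s; a is chosen between the two.
Testing the dilation on multiples of indicators of intervals turns the norm bound into a growth
condition on B. -/
theorem IsYoung.exists_mul_le_of_upperBoydIndex_lt {B : ℝ≥0 → ℝ≥0} (hB : IsYoung B)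
    (h : upperBoydIndex B < 1) :
    ∃ s a : ℝ≥0, 1 < a ∧ a < s ∧ ∀ t, s * B t ≤ B (a * t) := by
  obtain ⟨⟨s, hs⟩, hlog⟩ := exists_lt_of_ciInf_lt h
  simp only at hlog
  have hs' : (1 : ℝ) < s := hs
  lift s to ℝ≥0 using (zero_lt_one.trans hs').le
  have hs1 : 1 < s := by exact_mod_cast hs'
  have hs0 : 0 < s := zero_lt_one.trans hs1
  rw [div_lt_one (Real.log_pos hs')] at hlog
  have hle := hB.dilationNorm_le hs1
  have hfin : dilationNorm B s ≠ ⊤ := ne_top_of_le_ne_top ENNReal.coe_ne_top hle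
  have hlt : dilationNorm B s < s := by
    rw [← ENNReal.toReal_lt_toReal hfin ENNReal.coe_ne_top]
    rcases ENNReal.toReal_nonneg.eq_or_lt with h0 | h0
    · rw [← h0]; exact_mod_cast hs0
    · exact (Real.log_lt_log_iff h0 (by exact_mod_cast hs0)).1 hlog
  obtain ⟨a, ha, has⟩ := ENNReal.lt_iff_exists_nnreal_btwn.1 hlt
  have key : ∀ t, 0 < t → ∃ l, 0 < l ∧ l < a ∧ s * B (t / l) ≤ B t := by
    intro t ht
    have hBt : 0 < B t := hB.map_pos ht
    -- This function has modular exactly 1, and its dilate divided by l has modular s B(t / l) /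
    -- B(t).
    set f : ℝ → ℝ := (Ioo (0 : ℝ) (B t)⁻¹).indicator fun _ => (t : ℝ) with hf
    have hmod : ∀ (w : ℝ≥0) (l : ℝ≥0) (_ : 0 < l), modular B halfLine
        (fun τ => ‖(Ioo (0 : ℝ) w).indicator (fun _ => (t : ℝ)) τ‖ₑ / (l : ℝ≥0∞))
        = w * B (t / l) := by
      intro w l hl
      have : ∀ τ, extend B (‖(Ioo (0 : ℝ) w).indicator (fun _ => (t : ℝ)) τ‖ₑ / (l : ℝ≥0∞)) =
          (Ioo (0 : ℝ) w).indicator (fun _ => (B (t / l) : ℝ≥0∞)) τ := by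
        intro τ
        by_cases hτ : τ ∈ Ioo (0 : ℝ) w
        · rw [indicator_of_mem hτ, indicator_of_mem hτ, Real.enorm_eq_ofReal t.coe_nonneg,
            ENNReal.ofReal_coe_nnreal, ← ENNReal.coe_div hl.ne', extend_coe]
        · rw [indicator_of_notMem hτ, indicator_of_notMem hτ]
          simp [hB.extend_zero]
      simp only [modular, this]
      rw [lintegral_indicator_const measurableSet_Ioo, Measure.restrict_apply measurableSet_Ioo,
        inter_eq_self_of_subset_left (fun x hx => hx.1), Real.volume_Ioo, sub_zero,
        ENNReal.ofReal_coe_nnreal, mul_comm]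
    have hf1 : luxemburg B halfLine (fun τ => ‖f τ‖ₑ) ≤ 1 := by
      refine luxemburg_le one_pos ?_
      have := hmod (B t)⁻¹ 1 one_pos
      rw [NNReal.coe_inv] at this
      rw [this, div_one, ← ENNReal.coe_mul, inv_mul_cancel₀ hBt.ne', ENNReal.coe_one]
    have hfs : (fun τ => ‖f (τ / s)‖ₑ) = fun τ =>
        ‖(Ioo (0 : ℝ) (s * (B t)⁻¹ : ℝ≥0)).indicator (fun _ => (t : ℝ)) τ‖ₑ := by
      ext τ
      have hiff : τ / s ∈ Ioo (0 : ℝ) (B t)⁻¹ ↔ τ ∈ Ioo (0 : ℝ) (s * (B t)⁻¹ : ℝ≥0) := by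
        have hs0' : (0 : ℝ) < s := by exact_mod_cast hs0
        simp only [mem_Ioo, NNReal.coe_mul, NNReal.coe_inv]
        rw [div_lt_iff₀' hs0']
        exact and_congr_left' ⟨fun h => by
          have := mul_pos h hs0'
          rwa [div_mul_cancel₀ _ hs0'.ne'] at this, fun h => div_pos h hs0'⟩
      by_cases hτ : τ / s ∈ Ioo (0 : ℝ) (B t)⁻¹
      · rw [hf, indicator_of_mem hτ, indicator_of_mem (hiff.1 hτ)]
      · rw [hf, indicator_of_notMem hτ, indicator_of_notMem (mt hiff.2 hτ)]
    have hlux : luxemburg B halfLine (fun τ => ‖f (τ / s)‖ₑ) < a := by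
      refine lt_of_le_of_lt (le_iSup₂_of_le (f := fun (f : ℝ → ℝ) (_ : AEMeasurable f halfLine ∧
        luxemburg B halfLine (fun t => ‖f t‖ₑ) ≤ 1) =>
          luxemburg B halfLine (fun t => ‖f (t / s)‖ₑ)) f ⟨?_, hf1⟩ le_rfl) ha
      exact (measurable_const.indicator measurableSet_Ioo).aemeasurable
    rw [hfs] at hlux
    simp only [luxemburg, iInf_lt_iff] at hlux
    obtain ⟨l, ⟨hl0, hl⟩, hla⟩ := hlux
    refine ⟨l, hl0, by exact_mod_cast hla, ?_⟩
    rw [hmod _ _ hl0, ← ENNReal.coe_mul, ENNReal.coe_le_one_iff, mul_right_comm,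
      ← div_eq_mul_inv, div_le_one hBt] at hl
    exact hl
  have ha0 : 0 < a := by
    obtain ⟨l, hl0, hla, -⟩ := key 1 one_pos
    exact hl0.trans hla
  have hmain : ∀ t, s * B t ≤ B (a * t) := by
    intro t
    rcases (zero_le (a := t)).eq_or_lt with rfl | ht
    · simp [hB.map_zero]
    obtain ⟨l, hl0, hla, hl⟩ := key (a * t) (by positivity)
    refine le_trans ?_ hl
    gcongr
    refine hB.strictMono.monotone ?_
    rw [le_div_iff₀ hl0, mul_comm]
    gcongr
  refine ⟨s, a, ?_, by exact_mod_cast has, hmain⟩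
  by_contra! hcon
  have h1 := (hmain 1).trans (hB.strictMono.monotone (mul_le_mul_left hcon 1))
  rw [one_mul] at h1
  exact absurd h1 (not_le.2 (lt_mul_of_one_lt_left (hB.map_pos one_pos) hs1))

/-- For finite positive y a single term suffices: if aⁱ < y ≤ aⁱ⁺¹, then y / a ≤ aⁱ. For y = ∞ the
terms with i ≥ 0 are all at least B(1) > 0. -/
theorem IsYoung.extend_div_le_tsum {B : ℝ≥0 → ℝ≥0} (hB : IsYoung B) {a : ℝ≥0} (ha : 1 < a)
    (y : ℝ≥0∞) :
    extend B (y / a) ≤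
      ∑' i : ℤ, (if ((a ^ i : ℝ≥0) : ℝ≥0∞) < y then (B (a ^ i) : ℝ≥0∞) else 0) := by
  have ha0 : a ≠ 0 := (zero_lt_one.trans ha).ne'
  induction y with
  | top =>
    simp only [ENNReal.coe_lt_top, if_true]
    refine le_trans le_top ?_
    rw [← ENNReal.tsum_const_eq_top_of_ne_zero (α := ℕ) (c := (B 1 : ℝ≥0∞))
      (by simpa using (hB.map_pos one_pos).ne')]
    refine le_trans (ENNReal.tsum_le_tsum fun i : ℕ => ?_) (ENNReal.tsum_comp_le_tsum_of_injective
      (Nat.cast_injective (R := ℤ)) fun i => (B (a ^ i) : ℝ≥0∞))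
    have : 1 ≤ a ^ (i : ℤ) := one_le_zpow₀ ha.le (by positivity)
    exact_mod_cast hB.strictMono.monotone this
  | coe y =>
    rcases (zero_le (a := y)).eq_or_lt with rfl | hy
    · simp [hB.extend_zero]
    obtain ⟨i, hi, hi'⟩ := exists_mem_Ioc_zpow hy ha
    refine le_trans ?_ (ENNReal.le_tsum i)
    rw [if_pos (by exact_mod_cast hi), ← ENNReal.coe_div ha0, extend_coe, ENNReal.coe_le_coe]
    refine hB.strictMono.monotone ((div_le_iff₀ (zero_lt_one.trans ha)).2 ?_)
    rwa [← zpow_add_one₀ ha0]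

/-- Let I be the largest exponent with a^I < y. Iterating the growth condition gives B(a^(I-l)) ≤
s⁻ˡ B(y), so the term at I - l is at most a (a / s)ˡ B(y): a geometric series, convergent because a
< s. -/
theorem IsYoung.tsum_le_mul_extend {B : ℝ≥0 → ℝ≥0} (hB : IsYoung B) {s a : ℝ≥0} (ha : 1 < a)
    (has : a < s) (h : ∀ t, s * B t ≤ B (a * t)) (y : ℝ≥0∞) :
    ∑' i : ℤ, (if ((a ^ i : ℝ≥0) : ℝ≥0∞) < y then
      y * ((B (a ^ i) : ℝ≥0∞) / ((a ^ i : ℝ≥0) : ℝ≥0∞)) else 0) ≤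
      ((a * (1 - a / s)⁻¹ : ℝ≥0) : ℝ≥0∞) * extend B y := by
  have ha0 : 0 < a := zero_lt_one.trans ha
  have hs0 : 0 < s := ha0.trans has
  have hq : a / s < 1 := (div_lt_one hs0).2 has
  have hD : 0 < a * (1 - a / s)⁻¹ := mul_pos ha0 (inv_pos.2 (tsub_pos_of_lt hq))
  induction y with
  | top =>
    rw [extend_top, ENNReal.mul_top (by exact_mod_cast hD.ne')]
    exact le_top
  | coe y =>
    rcases (zero_le (a := y)).eq_or_lt with rfl | hy
    · simp
    obtain ⟨I, hI, hI'⟩ := exists_mem_Ioc_zpow hy ha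
    have hinj : Function.Injective fun l : ℕ => I - (l : ℤ) := fun l l' hl => by
      simpa using hl
    rw [← hinj.tsum_eq]
    · have hB' : ∀ l : ℕ, s ^ l * B (a ^ (I - (l : ℤ))) ≤ B (a ^ I) := by
        intro l
        induction l with
        | zero => simp
        | succ l ih =>
          refine le_trans ?_ ih
          rw [pow_succ, mul_assoc]
          gcongr
          refine (h _).trans_eq ?_
          rw [← zpow_one_add₀ ha0.ne']
          congr 2
          push_cast
          ring
      have hterm : ∀ l : ℕ, y * (B (a ^ (I - (l : ℤ))) / a ^ (I - (l : ℤ))) ≤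
          a * B y * (a / s) ^ l := by
        intro l
        have h1 : B (a ^ (I - (l : ℤ))) ≤ B y / s ^ l := by
          rw [le_div_iff₀ (by positivity), mul_comm]
          exact (hB' l).trans (hB.strictMono.monotone hI.le)
        calc y * (B (a ^ (I - (l : ℤ))) / a ^ (I - (l : ℤ)))
            ≤ a ^ (I + 1) * ((B y / s ^ l) / a ^ (I - (l : ℤ))) := by gcongr
          _ = a * B y * (a / s) ^ l := by
              rw [zpow_add_one₀ ha0.ne', zpow_sub₀ ha0.ne', zpow_natCast, div_pow]
              have : a ^ I ≠ 0 := zpow_ne_zero _ ha0.ne'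
              field_simp
      calc ∑' l : ℕ, (if ((a ^ (I - (l : ℤ)) : ℝ≥0) : ℝ≥0∞) < y then
            y * ((B (a ^ (I - (l : ℤ))) : ℝ≥0∞) / ((a ^ (I - (l : ℤ)) : ℝ≥0) : ℝ≥0∞)) else 0)
          ≤ ∑' l : ℕ, (((a * B y * (a / s) ^ l : ℝ≥0)) : ℝ≥0∞) := by
            refine ENNReal.tsum_le_tsum fun l => ?_
            split_ifs
            · rw [← ENNReal.coe_div (zpow_ne_zero _ ha0.ne'), ← ENNReal.coe_mul]
              exact_mod_cast hterm l
            · exact zero_le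
        _ = ((a * (1 - a / s)⁻¹ : ℝ≥0) : ℝ≥0∞) * extend B y := by
            rw [← ENNReal.coe_tsum ((NNReal.summable_geometric hq).mul_left _), NNReal.tsum_mul_left,
              NNReal.tsum_geometric hq, extend_coe, ← ENNReal.coe_mul]
            congr 1
            ring
    · intro i hi
      rw [Function.mem_support] at hi
      have hlt : a ^ i < y := by
        by_contra hcon
        exact hi (if_neg (by exact_mod_cast hcon))
      have : i < I + 1 := (zpow_lt_zpow_iff_right₀ ha).1 (hlt.trans_le hI')
      exact ⟨(I - i).toNat, by simp only; omega⟩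

/-- Marcinkiewicz interpolation over the levels aⁱ: the truncated weak type estimate is applied at
each level, sum and integral are exchanged, and the sum over the levels below f(x) is bounded by a
multiple of B(f(x)). -/
theorem IsYoung.modular_maximal_le {B : ℝ≥0 → ℝ≥0} (hB : IsYoung B) {n : ℕ} (hn : 1 ≤ n)
    {s a : ℝ≥0} (ha : 1 < a) (has : a < s) (h : ∀ t, s * B t ≤ B (a * t))
    {f : EuclideanSpace ℝ (Fin n) → ℝ≥0∞} (hf : AEMeasurable f) :
    modular B volume (fun x => maximal f x / ((2 * a : ℝ≥0) : ℝ≥0∞)) ≤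
      ((5 ^ n * (a * (1 - a / s)⁻¹) : ℝ≥0) : ℝ≥0∞) * modular B volume f := by
  have ha0 : 0 < a := zero_lt_one.trans ha
  have hpos : ∀ i : ℤ, ((a ^ i : ℝ≥0) : ℝ≥0∞) ≠ 0 := fun i => by
    simpa using (zpow_pos ha0 i).ne'
  have hdiv : ∀ x, maximal f x / ((2 * a : ℝ≥0) : ℝ≥0∞) = maximal f x / 2 / a := fun x => by
    rw [ENNReal.coe_mul, div_eq_mul_inv, ENNReal.mul_inv (Or.inl (by simp)) (Or.inl (by simp)),
      ← mul_assoc]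
    rfl
  have hlt : ∀ (i : ℤ) x, ((a ^ i : ℝ≥0) : ℝ≥0∞) < maximal f x / 2 ↔
      2 * ((a ^ i : ℝ≥0) : ℝ≥0∞) < maximal f x := fun i x => by
    rw [ENNReal.lt_div_iff_mul_lt (Or.inl (by simp)) (Or.inl (by simp)), mul_comm]
  have hmeas : ∀ i : ℤ, MeasurableSet {x | 2 * ((a ^ i : ℝ≥0) : ℝ≥0∞) < maximal f x} := fun i =>
    measurableSet_lt measurable_const (measurable_maximal f)
  have hnull : ∀ i : ℤ, NullMeasurableSet {x | ((a ^ i : ℝ≥0) : ℝ≥0∞) < f x} := fun i =>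
    nullMeasurableSet_lt aemeasurable_const hf
  calc modular B volume (fun x => maximal f x / ((2 * a : ℝ≥0) : ℝ≥0∞))
      ≤ ∫⁻ x, ∑' i : ℤ, {x | 2 * ((a ^ i : ℝ≥0) : ℝ≥0∞) < maximal f x}.indicator
          (fun _ => (B (a ^ i) : ℝ≥0∞)) x := by
        refine lintegral_mono fun x => ?_
        simp only [hdiv]
        refine (hB.extend_div_le_tsum ha _).trans_eq (tsum_congr fun i => ?_)
        simp only [hlt, indicator_apply, mem_ofPred_eq]
    _ = ∑' i : ℤ, B (a ^ i) * volume {x | 2 * ((a ^ i : ℝ≥0) : ℝ≥0∞) < maximal f x} := by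
        rw [lintegral_tsum fun i => (measurable_const.indicator (hmeas i)).aemeasurable]
        exact tsum_congr fun i => lintegral_indicator_const (hmeas i) _
    _ ≤ ∑' i : ℤ, 5 ^ n * ∫⁻ x, {x | ((a ^ i : ℝ≥0) : ℝ≥0∞) < f x}.indicator
          (fun x => f x * ((B (a ^ i) : ℝ≥0∞) / ((a ^ i : ℝ≥0) : ℝ≥0∞))) x := by
        refine ENNReal.tsum_le_tsum fun i => ?_
        rw [lintegral_indicator₀ (hnull i), lintegral_mul_const' _ _
          (ENNReal.div_ne_top ENNReal.coe_ne_top (hpos i))]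
        calc _ ≤ (B (a ^ i) : ℝ≥0∞) * (5 ^ n * ((∫⁻ x in {x | ((a ^ i : ℝ≥0) : ℝ≥0∞) < f x}, f x) /
                ((a ^ i : ℝ≥0) : ℝ≥0∞))) := by
              gcongr
              exact volume_two_mul_lt_maximal_le hf (hpos i) ENNReal.coe_ne_top hn
          _ = _ := by simp only [div_eq_mul_inv]; ring
    _ = 5 ^ n * ∫⁻ x, ∑' i : ℤ, {x | ((a ^ i : ℝ≥0) : ℝ≥0∞) < f x}.indicator
          (fun x => f x * ((B (a ^ i) : ℝ≥0∞) / ((a ^ i : ℝ≥0) : ℝ≥0∞))) x := by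
        rw [ENNReal.tsum_mul_left, lintegral_tsum fun i => (hf.mul_const _).indicator₀ (hnull i)]
    _ ≤ 5 ^ n * ∫⁻ x, ((a * (1 - a / s)⁻¹ : ℝ≥0) : ℝ≥0∞) * extend B (f x) := by
        gcongr with x
        refine le_trans (le_of_eq (tsum_congr fun i => ?_)) (hB.tsum_le_mul_extend ha has h (f x))
        simp only [indicator_apply, mem_ofPred_eq]
    _ = _ := by
        rw [lintegral_const_mul' _ _ ENNReal.coe_ne_top, ENNReal.coe_mul (5 ^ n), mul_assoc]
        simp [modular]

theorem maximal_div {n : ℕ} (f : EuclideanSpace ℝ (Fin n) → ℝ≥0∞) {l : ℝ≥0} (hl : 0 < l)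
    (x : EuclideanSpace ℝ (Fin n)) :
    maximal (fun y => f y / (l : ℝ≥0∞)) x = maximal f x / l := by
  have hl' : ((l : ℝ≥0∞))⁻¹ ≠ ⊤ := by simpa using hl.ne'
  simp only [maximal, div_eq_mul_inv, lintegral_mul_const' _ _ hl', ENNReal.iSup_mul]
  exact iSup_congr fun p => iSup_congr fun _ => mul_right_comm _ _ _

/-! ### Iterated derivatives of smooth functions -/

section IteratedFDeriv

variable {E : Type*} [NormedAddCommGroup E] [NormedSpace ℝ E]

theorem contDiff_iteratedFDeriv_apply {f : E → ℝ} (hf : ContDiff ℝ ∞ f) (m : ℕ) (w : Fin m → E) :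
    ContDiff ℝ ∞ fun y => iteratedFDeriv ℝ m f y w := by
  have h : ContDiff ℝ ∞ (iteratedFDeriv ℝ m f) := hf.iteratedFDeriv_right (by exact_mod_cast le_top)
  exact (ContinuousMultilinearMap.apply ℝ (fun _ : Fin m => E) ℝ w).contDiff.comp h

theorem contDiff_fderiv_apply_const {f : E → ℝ} (hf : ContDiff ℝ ∞ f) (v : E) :
    ContDiff ℝ ∞ fun y => fderiv ℝ f y v :=
  (hf.fderiv_right (by simp)).clm_apply contDiff_const

theorem iteratedFDeriv_succ_apply_eq_fderiv {f : E → ℝ} (hf : ContDiff ℝ ∞ f) {m : ℕ}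
    (w : Fin (m + 1) → E) (x : E) :
    iteratedFDeriv ℝ (m + 1) f x w =
      fderiv ℝ (fun y => iteratedFDeriv ℝ m f y (Fin.tail w)) x (w 0) := by
  have h : ContDiff ℝ ∞ (iteratedFDeriv ℝ m f) := hf.iteratedFDeriv_right (by exact_mod_cast le_top)
  rw [iteratedFDeriv_succ_apply_left]
  have hd := ((ContinuousMultilinearMap.apply ℝ (fun _ : Fin m => E) ℝ
    (Fin.tail w)).hasFDerivAt.comp x ((h.differentiable (by simp)) x).hasFDerivAt).fderiv
  exact (DFunLike.congr_fun hd (w 0)).symm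

theorem fderiv_fderiv_comm {f : E → ℝ} (hf : ContDiff ℝ ∞ f) (v w x : E) :
    fderiv ℝ (fun y => fderiv ℝ f y v) x w = fderiv ℝ (fun y => fderiv ℝ f y w) x v := by
  have hd : DifferentiableAt ℝ (fderiv ℝ f) x :=
    ((hf.fderiv_right (m := ∞) (by simp)).differentiable (by simp)) x
  have h : ∀ v w : E, fderiv ℝ (fun y => fderiv ℝ f y v) x w = fderiv ℝ (fderiv ℝ f) x w v := by
    intro v w
    rw [fderiv_clm_apply hd (differentiableAt_const v)]
    simp
  rw [h, h]
  exact (hf.contDiffAt.isSymmSndFDerivAt (by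
    rw [minSmoothness_of_isRCLikeNormedField]
    exact WithTop.coe_le_coe.2 (le_top (a := (2 : ℕ∞))))) w v

theorem fderiv_iteratedFDeriv_apply_comm {f : E → ℝ} (hf : ContDiff ℝ ∞ f) (m : ℕ)
    (w : Fin m → E) (v x : E) :
    fderiv ℝ (fun y => iteratedFDeriv ℝ m f y w) x v =
      iteratedFDeriv ℝ m (fun y => fderiv ℝ f y v) x w := by
  induction m generalizing x with
  | zero => simp
  | succ m ih =>
    rw [iteratedFDeriv_succ_apply_eq_fderiv (contDiff_fderiv_apply_const hf v)]
    simp only [iteratedFDeriv_succ_apply_eq_fderiv hf, ← ih]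
    exact fderiv_fderiv_comm (contDiff_iteratedFDeriv_apply hf m (Fin.tail w)) _ _ _

theorem iteratedFDeriv_comp_add_smul {f : E → ℝ} (hf : ContDiff ℝ ∞ f) (m : ℕ) (x : E) (a : ℝ)
    (w : Fin m → E) (y : E) :
    iteratedFDeriv ℝ m (fun y => f (x + a • y)) y w = a ^ m * iteratedFDeriv ℝ m f (x + a • y) w := by
  have haff : ContDiff ℝ ∞ fun y : E => x + a • y := by fun_prop
  induction m generalizing y with
  | zero => simp
  | succ m ih =>
    rw [iteratedFDeriv_succ_apply_eq_fderiv (f := fun y => f (x + a • y)) (hf.comp haff),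
      iteratedFDeriv_succ_apply_eq_fderiv hf]
    simp only [ih]
    have h1 : HasFDerivAt (fun y : E => x + a • y) (a • ContinuousLinearMap.id ℝ E) y :=
      ((hasFDerivAt_id y).const_smul a).const_add x
    have h2 := ((contDiff_iteratedFDeriv_apply hf m (Fin.tail w)).differentiable (by simp)
      (x + a • y)).hasFDerivAt
    have h3 := ((h2.comp y h1).const_mul (a ^ m)).fderiv
    have h4 := DFunLike.congr_fun h3 (w 0)
    simp only [Function.comp_def] at h4
    rw [h4]
    simp
    ring

theorem integral_iteratedFDeriv_mul [FiniteDimensional ℝ E] [MeasurableSpace E] [BorelSpace E]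
    {μ : Measure E} [μ.IsAddHaarMeasure] {V φ : E → ℝ} (hV : ContDiff ℝ ∞ V) (hφ : ContDiff ℝ ∞ φ)
    (hc : HasCompactSupport φ) (m : ℕ) (w : Fin m → E) :
    ∫ y, V y * iteratedFDeriv ℝ m φ y w ∂μ = (-1) ^ m * ∫ y, iteratedFDeriv ℝ m V y w * φ y ∂μ := by
  induction m generalizing φ with
  | zero => simp
  | succ m ih =>
    have hφ' := contDiff_fderiv_apply_const hφ (w 0)
    have hc' : HasCompactSupport fun y => fderiv ℝ φ y (w 0) := hc.fderiv_apply ℝ (w 0)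
    have hD := contDiff_iteratedFDeriv_apply hV m (Fin.tail w)
    simp only [iteratedFDeriv_succ_apply_eq_fderiv hφ, iteratedFDeriv_succ_apply_eq_fderiv hV,
      fderiv_iteratedFDeriv_apply_comm hφ]
    rw [ih hφ' hc', integral_mul_fderiv_eq_neg_fderiv_mul_of_integrable]
    · rw [pow_succ]; ring
    · exact ((contDiff_fderiv_apply_const hD (w 0)).continuous.mul hφ.continuous
        ).integrable_of_hasCompactSupport hc.mul_left
    · exact (hD.continuous.mul hφ'.continuous).integrable_of_hasCompactSupport hc'.mul_left
    · exact (hD.continuous.mul hφ.continuous).integrable_of_hasCompactSupport hc.mul_left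
    · exact fun y _ => hD.differentiable (by simp) y
    · exact fun y _ => hφ.differentiable (by simp) y

theorem iteratedFDeriv_convolution [FiniteDimensional ℝ E] [MeasurableSpace E] [BorelSpace E]
    {μ : Measure E} [μ.IsAddHaarMeasure] {u φ : E → ℝ} (hu : LocallyIntegrable u μ)
    (hφ : ContDiff ℝ ∞ φ) (hc : HasCompactSupport φ) (m : ℕ) (w : Fin m → E) (x : E) :
    iteratedFDeriv ℝ m (convolution u φ (ContinuousLinearMap.lsmul ℝ ℝ) μ) x w =
      ∫ t, u t * iteratedFDeriv ℝ m φ (x - t) w ∂μ := by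
  induction m generalizing φ with
  | zero => simp [convolution]
  | succ m ih =>
    have hU : ContDiff ℝ ∞ (convolution u φ (ContinuousLinearMap.lsmul ℝ ℝ) μ) :=
      hc.contDiff_convolution_right _ hu hφ
    rw [iteratedFDeriv_succ_apply_eq_fderiv hU, fderiv_iteratedFDeriv_apply_comm hU]
    have hfd : (fun y => fderiv ℝ (convolution u φ (ContinuousLinearMap.lsmul ℝ ℝ) μ) y (w 0)) =
        convolution u (fun y => fderiv ℝ φ y (w 0)) (ContinuousLinearMap.lsmul ℝ ℝ) μ := by
      ext y
      rw [(hc.hasFDerivAt_convolution_right _ hu (hφ.of_le (by simp)) y).fderiv,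
        convolution_precompR_apply _ hu (hc.fderiv ℝ) (hφ.continuous_fderiv (by simp))]
    rw [hfd, ih (contDiff_fderiv_apply_const hφ (w 0)) (hc.fderiv_apply ℝ (w 0))]
    simp only [iteratedFDeriv_succ_apply_eq_fderiv hφ, fderiv_iteratedFDeriv_apply_comm hφ]

theorem hasDerivAt_integral_mul_of_continuous [FiniteDimensional ℝ E] [MeasurableSpace E]
    [BorelSpace E] {μ : Measure E} [IsFiniteMeasureOnCompacts μ] {G G' : ℝ → E → ℝ} {φ : E → ℝ}
    (hG : Continuous (Function.uncurry G)) (hG' : Continuous (Function.uncurry G'))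
    (hd : ∀ r y, HasDerivAt (fun r => G r y) (G' r y) r) (hφ : Continuous φ)
    (hc : HasCompactSupport φ) (r : ℝ) :
    HasDerivAt (fun r => ∫ y, G r y * φ y ∂μ) (∫ y, G' r y * φ y ∂μ) r := by
  have hK : IsCompact (closedBall r 1 ×ˢ tsupport φ) := (isCompact_closedBall r 1).prod hc
  obtain ⟨c, hbound⟩ := hK.exists_bound_of_continuousOn hG'.continuousOn
  have hGr : ∀ r, Continuous (G r) := fun r => hG.comp (by fun_prop : Continuous fun y => (r, y))
  have hG'r : ∀ r, Continuous (G' r) := fun r => hG'.comp (by fun_prop : Continuous fun y => (r, y))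
  refine (hasDerivAt_integral_of_dominated_loc_of_deriv_le (F := fun r y => G r y * φ y)
    (F' := fun r y => G' r y * φ y) (bound := fun y => c * ‖φ y‖) (s := closedBall r 1)
    (closedBall_mem_nhds r one_pos)
    (Eventually.of_forall fun r => ((hGr r).mul hφ).aestronglyMeasurable)
    (((hGr r).mul hφ).integrable_of_hasCompactSupport hc.mul_left)
    ((hG'r r).mul hφ).aestronglyMeasurable
    (Eventually.of_forall fun y q hq => ?_)
    ((hφ.norm.integrable_of_hasCompactSupport hc.norm).const_mul c)
    (Eventually.of_forall fun y q _ => (hd q y).mul_const (φ y))).2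
  rw [norm_mul]
  by_cases hy : y ∈ tsupport φ
  · gcongr
    exact hbound (q, y) ⟨hq, hy⟩
  · simp [image_eq_zero_of_notMem_tsupport hy]

end IteratedFDeriv

/-! ### Finite differences -/

/-- Differencing commutes with differentiation, so the induction passes to the differences of all `F
i`; the mean value inequality contributes one factor h each time. -/
theorem abs_fwdDiff_iter_le (m : ℕ) {F : ℕ → ℝ → ℝ} {N h : ℝ} (hh : 0 ≤ h)
    (hF : ∀ i s, HasDerivAt (F i) (F (i + 1) s) s) (hN : ∀ s, 0 ≤ s → |F m s| ≤ N) :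
    ∀ s, 0 ≤ s → |(fwdDiff h)^[m] (F 0) s| ≤ h ^ m * N := by
  induction m generalizing F N with
  | zero => simpa using hN
  | succ m ih =>
    intro s hs
    rw [Function.iterate_succ_apply]
    have hder : ∀ i s, HasDerivAt (fwdDiff h (F i)) (fwdDiff h (F (i + 1)) s) s := fun i s => by
      have h1 : HasDerivAt (fun s => F i (s + h)) (F (i + 1) (s + h)) s := by
        simpa using (hF i (s + h)).comp_add_const s h
      exact h1.sub (hF i s)
    have := ih (F := fun i => fwdDiff h (F i)) (N := h * N) hder (fun s hs => ?_) s hs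
    · rw [pow_succ, mul_assoc]
      exact this
    · have hmv := (convex_Ici (0 : ℝ)).norm_image_sub_le_of_norm_hasDerivWithin_le (f := F m)
        (f' := F (m + 1)) (C := N) (x := s) (y := s + h)
        (fun x _ => (hF m x).hasDerivWithinAt) (fun x hx => hN x hx) (mem_Ici.2 hs)
        (mem_Ici.2 (by positivity))
      rw [add_sub_cancel_left, Real.norm_eq_abs, Real.norm_eq_abs, abs_of_nonneg hh] at hmv
      rw [mul_comm h N]
      exact hmv

/-- In the m-th difference at 0 the value at 0 has coefficient ±1 and all other nodes are i h ≥ h.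
Their binomial coefficients sum to at most 2ᵐ. -/
theorem abs_apply_zero_le_of_hasDerivAt {m : ℕ} {F : ℕ → ℝ → ℝ} {N P h : ℝ} (hh : 0 < h)
    (hF : ∀ i s, HasDerivAt (F i) (F (i + 1) s) s) (hN : ∀ s, 0 ≤ s → |F m s| ≤ N)
    (hP : ∀ s, h ≤ s → |F 0 s| ≤ P) : |F 0 0| ≤ 2 ^ m * P + h ^ m * N := by
  have h1 := abs_fwdDiff_iter_le m hh.le hF hN 0 le_rfl
  rw [fwdDiff_iter_eq_sum_shift, Finset.sum_range_succ'] at h1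
  have hP0 : 0 ≤ P := (abs_nonneg _).trans (hP h le_rfl)
  set S := ∑ i ∈ Finset.range m, ((-1 : ℤ) ^ (m - (i + 1)) * (m.choose (i + 1) : ℤ)) •
    F 0 (0 + (i + 1) • h) with hS
  have hSle : |S| ≤ 2 ^ m * P := by
    calc |S| ≤ ∑ i ∈ Finset.range m, (m.choose (i + 1) : ℝ) * P := by
          refine (Finset.abs_sum_le_sum_abs _ _).trans (Finset.sum_le_sum fun i _ => ?_)
          rw [zsmul_eq_mul, abs_mul]
          push_cast
          rw [abs_mul, abs_pow, abs_neg, abs_one, one_pow, one_mul, Nat.abs_cast]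
          gcongr
          refine hP _ ?_
          rw [zero_add, nsmul_eq_mul]
          refine le_mul_of_one_le_left hh.le ?_
          push_cast
          linarith [(Nat.cast_nonneg i : (0 : ℝ) ≤ i)]
      _ = (∑ i ∈ Finset.range m, (m.choose (i + 1) : ℝ)) * P := by rw [Finset.sum_mul]
      _ ≤ 2 ^ m * P := by
          gcongr
          have h2 := Nat.sum_range_choose m
          rw [Finset.sum_range_succ'] at h2
          exact_mod_cast (Nat.le_add_right _ _).trans h2.le
  have h3 : |F 0 0| ≤ |S + ((-1 : ℤ) ^ (m - 0) * (m.choose 0 : ℤ)) • F 0 (0 + 0 • h)| + |S| := by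
    have h4 : |F 0 0| = |((-1 : ℤ) ^ (m - 0) * (m.choose 0 : ℤ)) • F 0 (0 + 0 • h)| := by
      simp [abs_mul]
    rw [h4]
    have := abs_sub (S + ((-1 : ℤ) ^ (m - 0) * (m.choose 0 : ℤ)) • F 0 (0 + 0 • h)) S
    rwa [add_sub_cancel_left] at this
  linarith

theorem abs_multilinear_apply_le {n m : ℕ}
    (f : ContinuousMultilinearMap ℝ (fun _ : Fin m => EuclideanSpace ℝ (Fin n)) ℝ)
    {w : Fin m → EuclideanSpace ℝ (Fin n)} (hw : ∀ i, ‖w i‖ ≤ 1) :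
    |f w| ≤ ∑ β : Fin m → Fin n, |f fun i => EuclideanSpace.single (β i) (1 : ℝ)| := by
  have hexp : w = fun i => ∑ l : Fin n, w i l • EuclideanSpace.single l (1 : ℝ) := by
    ext i l
    simp [Pi.single_apply]
  rw [hexp, f.map_sum]
  refine (Finset.abs_sum_le_sum_abs _ _).trans (Finset.sum_le_sum fun β _ => ?_)
  rw [f.map_smul_univ, smul_eq_mul, abs_mul, Finset.abs_prod]
  refine mul_le_of_le_one_left (abs_nonneg _) (Finset.prod_le_one (fun _ _ => abs_nonneg _) ?_)
  exact fun i _ => (PiLp.norm_apply_le (w i) (β i)).trans (hw i)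

/-! ### The pointwise inequality for smooth functions -/

/-- The directions `w` preceded by `i` copies of `y`. -/
def prependDirections {E : Type*} {j : ℕ} (w : Fin j → E) (y : E) : (i : ℕ) → Fin (j + i) → E
  | 0 => w
  | i + 1 => Fin.cons (α := fun _ => E) y (prependDirections w y i)

theorem norm_prependDirections_le {E : Type*} [NormedAddCommGroup E] {j : ℕ} {w : Fin j → E}
    {y : E} (hw : ∀ i, ‖w i‖ ≤ 1) (hy : ‖y‖ ≤ 1) (i : ℕ) :
    ∀ l, ‖prependDirections w y i l‖ ≤ 1 := by
  induction i with
  | zero => exact hw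
  | succ i ih => exact fun l => Fin.cases hy ih l

theorem continuous_prependDirections {E : Type*} [NormedAddCommGroup E] {j : ℕ} (w : Fin j → E)
    (i : ℕ) : Continuous fun y => prependDirections w y i := by
  induction i with
  | zero => exact continuous_const
  | succ i ih => exact Continuous.finCons continuous_id ih

theorem abs_integral_mul_le {E : Type*} [NormedAddCommGroup E] [NormedSpace ℝ E]
    [FiniteDimensional ℝ E] [MeasurableSpace E] [BorelSpace E] {μ : Measure E}
    [IsFiniteMeasureOnCompacts μ] {f g ψ : E → ℝ} {c : ℝ} (hg : Continuous g)
    (hψ : ∀ y, |ψ y| ≤ c) (hsupp : ∀ y, y ∉ ball (0 : E) 1 → ψ y = 0)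
    (hfg : ∀ y ∈ ball (0 : E) 1, |f y| ≤ g y) :
    |∫ y, f y * ψ y ∂μ| ≤ c * ∫ y in ball (0 : E) 1, g y ∂μ := by
  have hc : 0 ≤ c := (abs_nonneg _).trans (hψ 0)
  have h1 : ∫ y, f y * ψ y ∂μ = ∫ y in ball (0 : E) 1, f y * ψ y ∂μ := by
    refine (setIntegral_eq_integral_of_forall_compl_eq_zero fun y hy => ?_).symm
    rw [hsupp y hy, mul_zero]
  rw [h1, ← integral_const_mul, ← Real.norm_eq_abs]
  have hint : IntegrableOn g (ball (0 : E) 1) μ :=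
    (hg.continuousOn.integrableOn_compact (isCompact_closedBall 0 1)).mono_set
      ball_subset_closedBall
  refine norm_integral_le_of_norm_le (hint.const_mul c) ?_
  filter_upwards [ae_restrict_mem measurableSet_ball] with y hy
  rw [norm_mul, mul_comm]
  exact mul_le_mul (hψ y) (hfg y hy) (abs_nonneg _) hc

/-- A derivative of order `j` is controlled by means, over all scales, of the function and of its
derivatives of order `j + m`. -/
theorem exists_abs_iteratedFDeriv_le (n j m : ℕ) : ∃ c : ℝ, 0 < c ∧
    ∀ (U : EuclideanSpace ℝ (Fin n) → ℝ) (x : EuclideanSpace ℝ (Fin n)) (P N : ℝ),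
      ContDiff ℝ ∞ U → 0 ≤ N →
      (∀ r : ℝ, 0 < r → ∫ y in ball (0 : EuclideanSpace ℝ (Fin n)) 1, |U (x + r • y)| ≤ P) →
      (∀ r : ℝ, 0 ≤ r → ∀ β : Fin (j + m) → Fin n,
        ∫ y in ball (0 : EuclideanSpace ℝ (Fin n)) 1,
          |iteratedFDeriv ℝ (j + m) U (x + r • y) fun i => EuclideanSpace.single (β i) 1| ≤ N) →
      ∀ (α : Fin j → Fin n) (h : ℝ), 0 < h →
        |iteratedFDeriv ℝ j U x fun i => EuclideanSpace.single (α i) 1| ≤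
          c * (P / h ^ j + h ^ m * N) := by
  let b : ContDiffBump (0 : EuclideanSpace ℝ (Fin n)) := ⟨1 / 4, 1 / 2, by norm_num, by norm_num⟩
  set φ := b.normed volume with hφdef
  have hφ : ContDiff ℝ ∞ φ := b.contDiff_normed
  have hφc : HasCompactSupport φ := b.hasCompactSupport_normed
  have hts : tsupport φ ⊆ ball (0 : EuclideanSpace ℝ (Fin n)) 1 := by
    rw [hφdef, b.tsupport_normed_eq]
    exact closedBall_subset_ball (by norm_num [b])
  obtain ⟨c₁, hc₁⟩ := hφc.exists_bound_of_continuous hφ.continuous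
  obtain ⟨c₂, hc₂⟩ := (hφc.iteratedFDeriv (𝕜 := ℝ) j).exists_bound_of_continuous
    (hφ.continuous_iteratedFDeriv (m := j) (by exact_mod_cast le_top))
  have hc₁0 : 0 ≤ c₁ := (norm_nonneg _).trans (hc₁ 0)
  have hc₂0 : 0 ≤ c₂ := (norm_nonneg _).trans (hc₂ 0)
  set L : ℝ := ((Fintype.card (Fin (j + m) → Fin n) : ℕ) : ℝ) with hL
  refine ⟨2 ^ m * c₂ + c₁ * L + 1, by positivity, fun U x P N hU hN0 hP hN α h hh => ?_⟩
  set w : Fin j → EuclideanSpace ℝ (Fin n) := fun i => EuclideanSpace.single (α i) 1 with hw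
  have hw1 : ∀ i, ‖w i‖ ≤ 1 := fun i => by simp [hw]
  have hP0 : 0 ≤ P := le_trans (integral_nonneg fun y => abs_nonneg _) (hP 1 one_pos)
  have hcont : ∀ i, Continuous (iteratedFDeriv ℝ i U) := fun i =>
    hU.continuous_iteratedFDeriv (m := i) (by exact_mod_cast le_top)
  -- The i-th derivative in s of DʲU(x + s y)[w]: each differentiation adds the direction y. On the
  -- unit ball all directions have norm at most 1.
  let G : ℕ → ℝ → EuclideanSpace ℝ (Fin n) → ℝ := fun i s y =>
    iteratedFDeriv ℝ (j + i) U (x + s • y) (prependDirections w y i)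
  have hG : ∀ i, Continuous (Function.uncurry (G i)) := fun i => by
    have h1 : Continuous fun p : ℝ × EuclideanSpace ℝ (Fin n) =>
        iteratedFDeriv ℝ (j + i) U (x + p.1 • p.2) := (hcont _).comp (by fun_prop)
    exact h1.eval ((continuous_prependDirections w i).comp continuous_snd)
  have hGd : ∀ i s y, HasDerivAt (fun s => G i s y) (G (i + 1) s y) s := fun i s y => by
    have h1 : HasDerivAt (fun s : ℝ => x + s • y) y s := by
      simpa using ((hasDerivAt_id s).smul_const y).const_add x
    have h2 := ((contDiff_iteratedFDeriv_apply hU (j + i)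
      (prependDirections w y i)).differentiable (by simp) (x + s • y)).hasFDerivAt
    have h3 := h2.comp_hasDerivAt s h1
    have h4 := iteratedFDeriv_succ_apply_eq_fderiv hU (prependDirections w y (i + 1)) (x + s • y)
    rw [show G (i + 1) s y = _ from h4]
    exact h3
  let F : ℕ → ℝ → ℝ := fun i s => ∫ y, G i s y * φ y
  have hFd : ∀ i s, HasDerivAt (F i) (F (i + 1) s) s := fun i s =>
    hasDerivAt_integral_mul_of_continuous (hG i) (hG (i + 1)) (hGd i) hφ.continuous hφc s
  have hF0 : F 0 0 = iteratedFDeriv ℝ j U x w := by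
    simp only [F, G, zero_smul, add_zero, prependDirections]
    rw [integral_const_mul, b.integral_normed, mul_one]
    rfl
  have hFN : ∀ s, 0 ≤ s → |F m s| ≤ c₁ * (L * N) := by
    intro s hs
    have hcβ : ∀ β : Fin (j + m) → Fin n, Continuous fun y : EuclideanSpace ℝ (Fin n) =>
        |iteratedFDeriv ℝ (j + m) U (x + s • y) fun i => EuclideanSpace.single (β i) 1| :=
      fun β => ((contDiff_iteratedFDeriv_apply hU (j + m) _).continuous.comp (by fun_prop)).abs
    refine (abs_integral_mul_le (g := fun y => ∑ β : Fin (j + m) → Fin n,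
      |iteratedFDeriv ℝ (j + m) U (x + s • y) fun i => EuclideanSpace.single (β i) 1|)
      (continuous_finsetSum _ fun β _ => hcβ β) hc₁
      (fun y hy => image_eq_zero_of_notMem_tsupport fun hy' => hy (hts hy'))
      fun y hy => abs_multilinear_apply_le _ (norm_prependDirections_le hw1
        (by simpa using (mem_ball_zero_iff.1 hy).le) m)).trans ?_
    gcongr
    rw [integral_finsetSum _ fun β _ => ((hcβ β).continuousOn.integrableOn_compact
      (isCompact_closedBall 0 1)).mono_set ball_subset_closedBall]
    refine (Finset.sum_le_sum fun β _ => hN s hs β).trans_eq ?_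
    simp [hL]
  -- Derivatives in y of U(x + s y) carry the factor sʲ, so integrating by parts j times gives sʲ |F
  -- 0 s| ≤ c₂ P. This is useless near s = 0, hence the finite difference.
  have hFP : ∀ s, h ≤ s → |F 0 s| ≤ c₂ * (P / h ^ j) := by
    intro s hs
    have hs0 : 0 < s := hh.trans_le hs
    have haff : ContDiff ℝ ∞ fun y : EuclideanSpace ℝ (Fin n) => x + s • y := by fun_prop
    have hV : ContDiff ℝ ∞ fun y => U (x + s • y) := hU.comp haff
    have hibp := integral_iteratedFDeriv_mul (μ := volume) hV hφ hφc j w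
    simp only [iteratedFDeriv_comp_add_smul hU] at hibp
    have h1 : |∫ y, U (x + s • y) * iteratedFDeriv ℝ j φ y w| = s ^ j * |F 0 s| := by
      rw [hibp, abs_mul, abs_pow, abs_neg, abs_one, one_pow, one_mul]
      simp only [mul_assoc]
      rw [integral_const_mul, abs_mul, abs_of_pos (pow_pos hs0 j)]
      rfl
    have h2 : |∫ y, U (x + s • y) * iteratedFDeriv ℝ j φ y w| ≤ c₂ * P := by
      refine (abs_integral_mul_le (g := fun y => |U (x + s • y)|) hV.continuous.abs
        (c := c₂) (fun y => ?_) (fun y hy => ?_) fun y _ => le_rfl).trans ?_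
      · refine ((iteratedFDeriv ℝ j φ y).le_opNorm w).trans ?_
        refine (mul_le_of_le_one_right (norm_nonneg _)
          (Finset.prod_le_one (fun _ _ => norm_nonneg _) fun i _ => hw1 i)).trans (hc₂ y)
      · have : iteratedFDeriv ℝ j φ y = 0 := by
          by_contra hne
          exact hy (hts (support_iteratedFDeriv_subset j hne))
        simp [this]
      · gcongr
        exact hP s hs0
    rw [h1] at h2
    rw [← mul_div_assoc, le_div_iff₀ (by positivity), mul_comm]
    refine le_trans ?_ h2
    gcongr
  have hfin := abs_apply_zero_le_of_hasDerivAt hh hFd hFN hFP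
  rw [hF0] at hfin
  have hPh : 0 ≤ P / h ^ j := by positivity
  have hNh : 0 ≤ h ^ m * N := by positivity
  have hL0 : 0 ≤ L := by positivity
  calc _ ≤ 2 ^ m * (c₂ * (P / h ^ j)) + h ^ m * (c₁ * (L * N)) := hfin
    _ = (2 ^ m * c₂) * (P / h ^ j) + (c₁ * L) * (h ^ m * N) := by ring
    _ ≤ (2 ^ m * c₂ + c₁ * L + 1) * (P / h ^ j) + (2 ^ m * c₂ + c₁ * L + 1) * (h ^ m * N) := by
        have h1 : 0 ≤ 2 ^ m * c₂ := by positivity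
        have h2 : 0 ≤ c₁ * L := by positivity
        gcongr <;> linarith
    _ = _ := by ring

/-! ### Mollification and the pointwise inequality for weakly differentiable functions -/

theorem HasWeakGrad.locallyIntegrable_apply {n m : ℕ} {u : EuclideanSpace ℝ (Fin n) → ℝ}
    {v : EuclideanSpace ℝ (Fin n) → EuclideanSpace ℝ (Fin m → Fin n)} (h : HasWeakGrad m u v)
    (α : Fin m → Fin n) : LocallyIntegrable (fun x => v x α) volume :=
  fun x => (h.1 x).imp fun _ hs => ⟨hs.1, (EuclideanSpace.proj (𝕜 := ℝ) α).integrable_comp hs.2⟩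

/-- The derivatives fall on φ, and t ↦ φ(x - t) is an admissible test function; its reflection
produces a sign (-1)ᵐ that cancels the one in the definition of weak derivatives. -/
theorem HasWeakGrad.iteratedFDeriv_convolution {n m : ℕ} {u φ : EuclideanSpace ℝ (Fin n) → ℝ}
    {v : EuclideanSpace ℝ (Fin n) → EuclideanSpace ℝ (Fin m → Fin n)} (h : HasWeakGrad m u v)
    (hu : LocallyIntegrable u volume) (hφ : ContDiff ℝ ∞ φ) (hc : HasCompactSupport φ)
    (α : Fin m → Fin n) (x : EuclideanSpace ℝ (Fin n)) :
    iteratedFDeriv ℝ m (convolution u φ (ContinuousLinearMap.lsmul ℝ ℝ) volume) x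
        (fun i => EuclideanSpace.single (α i) 1) =
      convolution (fun y => v y α) φ (ContinuousLinearMap.lsmul ℝ ℝ) volume x := by
  rw [GNOrlicz.iteratedFDeriv_convolution hu hφ hc]
  have haff : ContDiff ℝ ∞ fun t : EuclideanSpace ℝ (Fin n) => x + (-1 : ℝ) • t := by fun_prop
  have hψc : HasCompactSupport fun t => φ (x + (-1 : ℝ) • t) := by
    have := hc.comp_homeomorph (Homeomorph.subLeft x)
    simpa [Function.comp_def, sub_eq_add_neg] using this
  have hw := h.2 _ (hφ.comp haff) hψc α
  simp only [Function.comp_def] at hw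
  simp only [iteratedFDeriv_comp_add_smul hφ] at hw
  have hone : ((-1 : ℝ) ^ m) * (-1) ^ m = 1 := by rw [← mul_pow]; simp
  have h1 : ∀ t, u t * ((-1) ^ m * iteratedFDeriv ℝ m φ (x + (-1 : ℝ) • t)
      fun i => EuclideanSpace.single (α i) 1) = (-1) ^ m * (u t * iteratedFDeriv ℝ m φ (x - t)
      fun i => EuclideanSpace.single (α i) 1) := fun t => by
    rw [neg_one_smul, ← sub_eq_add_neg]; ring
  simp only [h1] at hw
  rw [integral_const_mul] at hw
  have h2 := congrArg (fun z => (-1 : ℝ) ^ m * z) hw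
  simp only [← mul_assoc, hone, one_mul] at h2
  rw [h2]
  simp [convolution, sub_eq_add_neg]

theorem setLIntegral_ball_comp_add_smul {n : ℕ} {f : EuclideanSpace ℝ (Fin n) → ℝ≥0∞}
    (hf : Measurable f) (x : EuclideanSpace ℝ (Fin n)) {r : ℝ} (hr : 0 < r) :
    ∫⁻ y in ball (0 : EuclideanSpace ℝ (Fin n)) 1, f (x + r • y) =
      ENNReal.ofReal ((r ^ n)⁻¹) * ∫⁻ z in ball x r, f z := by
  rw [← lintegral_indicator measurableSet_ball, ← lintegral_indicator measurableSet_ball]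
  have hmap := Measure.map_addHaar_smul (volume : Measure (EuclideanSpace ℝ (Fin n))) hr.ne'
  rw [finrank_euclideanSpace_fin, abs_of_pos (by positivity)] at hmap
  calc ∫⁻ y, (ball (0 : EuclideanSpace ℝ (Fin n)) 1).indicator (fun y => f (x + r • y)) y
      = ∫⁻ y, (ball x r).indicator f (x + r • y) := by
        refine lintegral_congr fun y => ?_
        have hiff : x + r • y ∈ ball x r ↔ y ∈ ball (0 : EuclideanSpace ℝ (Fin n)) 1 := by
          rw [mem_ball_iff_norm, add_sub_cancel_left, norm_smul, Real.norm_of_nonneg hr.le,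
            mem_ball_zero_iff]
          exact mul_lt_iff_lt_one_right hr
        by_cases hy : y ∈ ball (0 : EuclideanSpace ℝ (Fin n)) 1
        · rw [indicator_of_mem hy, indicator_of_mem (hiff.2 hy)]
        · rw [indicator_of_notMem hy, indicator_of_notMem (mt hiff.1 hy)]
    _ = ∫⁻ z, (ball x r).indicator f (x + z) ∂(Measure.map (r • ·) volume) := by
        exact (lintegral_map ((hf.indicator measurableSet_ball).comp (measurable_const_add x))
          (measurable_const_smul r)).symm
    _ = _ := by
        rw [hmap, lintegral_smul_measure, smul_eq_mul,
          lintegral_add_left_eq_self ((ball x r).indicator f) x]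

theorem volume_ball_two_mul {n : ℕ} (x : EuclideanSpace ℝ (Fin n)) {r : ℝ} (hr : 0 < r) :
    volume (ball x (2 * r)) = 2 ^ n * volume (ball x r) := by
  rw [Measure.addHaar_ball_of_pos _ _ (by positivity), Measure.addHaar_ball_of_pos _ _ hr, mul_pow,
    ENNReal.ofReal_mul (by positivity), ENNReal.ofReal_pow (by norm_num)]
  simp [mul_assoc]

/-- Means of a mollified function are controlled by the maximal function. -/
theorem setLIntegral_convolution_le_maximal {n : ℕ} {g : EuclideanSpace ℝ (Fin n) → ℝ}
    (hg : AEStronglyMeasurable g volume) (b : ContDiffBump (0 : EuclideanSpace ℝ (Fin n)))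
    (hb : b.rOut ≤ 2 * b.rIn) (x : EuclideanSpace ℝ (Fin n)) {r : ℝ} (hr : 0 ≤ r) :
    ∫⁻ y in ball (0 : EuclideanSpace ℝ (Fin n)) 1,
      ‖convolution g (b.normed volume) (ContinuousLinearMap.lsmul ℝ ℝ) volume (x + r • y)‖ₑ ≤
      4 ^ n * volume (ball (0 : EuclideanSpace ℝ (Fin n)) 1) * maximal (fun y => ‖g y‖ₑ) x := by
  -- A measurable representative changes neither the convolution nor the maximal function, and makes
  -- Tonelli applicable.
  wlog hgm : StronglyMeasurable g generalizing g
  · have h := this hg.stronglyMeasurable_mk.aestronglyMeasurable hg.stronglyMeasurable_mk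
    have hae := hg.ae_eq_mk
    have hmax : maximal (fun y => ‖g y‖ₑ) = maximal fun y => ‖hg.mk g y‖ₑ :=
      maximal_congr_ae (hae.mono fun y hy => by simp only [hy])
    have hconv : convolution g (b.normed volume) (ContinuousLinearMap.lsmul ℝ ℝ) volume =
        convolution (hg.mk g) (b.normed volume) (ContinuousLinearMap.lsmul ℝ ℝ) volume := by
      ext z
      exact integral_congr_ae (hae.mono fun y hy => by simp only [hy])
    rwa [hmax, hconv]
  set φ := b.normed volume with hφ
  set ε := b.rOut with hε
  have hε0 : 0 < ε := b.rOut_pos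
  have hsupp : ∀ z, z ∉ ball (0 : EuclideanSpace ℝ (Fin n)) ε → φ z = 0 := fun z hz => by
    rw [← Function.notMem_support, hφ, b.support_normed_eq]
    exact hz
  have hgE : Measurable fun y => ‖g y‖ₑ := hgm.enorm
  have hφm : Measurable fun z => ‖φ z‖ₑ := b.continuous_normed.enorm.measurable
  -- For r < ε the convolution is bounded pointwise: φ ≤ 2ⁿ / |B(x, ε)|, and only values of g on
  -- B(x, 2ε) are used, whence 2ⁿ · 2ⁿ. For r ≥ ε the integrals are exchanged and each translated
  -- ball B(x - w, r) lies in B(x, 2r).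
  rcases lt_or_ge r ε with hrε | hrε
  · set M := maximal (fun y => ‖g y‖ₑ) x with hM
    have hφle : ∀ z, ‖φ z‖ₑ ≤ 2 ^ n / volume (ball x ε) := by
      intro z
      have h1 := b.normed_le_div_measure_closedBall_rOut volume 2 hb z
      rw [finrank_euclideanSpace_fin] at h1
      rw [Real.enorm_eq_ofReal (b.nonneg_normed z)]
      have hv : volume (ball x ε) = volume (closedBall (0 : EuclideanSpace ℝ (Fin n)) ε) := by
        rw [Measure.addHaar_ball_of_pos _ _ hε0, Measure.addHaar_closedBall _ _ hε0.le]
      have hpos : 0 < volume.real (closedBall (0 : EuclideanSpace ℝ (Fin n)) ε) :=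
        ENNReal.toReal_pos (measure_closedBall_pos volume _ hε0).ne' measure_closedBall_lt_top.ne
      refine (ENNReal.ofReal_le_ofReal h1).trans ?_
      rw [ENNReal.ofReal_div_of_pos hpos, hv, ofReal_measureReal measure_closedBall_lt_top.ne,
        ENNReal.ofReal_pow (by norm_num)]
      simp
    have hpt : ∀ y ∈ ball (0 : EuclideanSpace ℝ (Fin n)) 1,
        ‖convolution g φ (ContinuousLinearMap.lsmul ℝ ℝ) volume (x + r • y)‖ₑ ≤ 4 ^ n * M := by
      intro y hy
      calc ‖convolution g φ (ContinuousLinearMap.lsmul ℝ ℝ) volume (x + r • y)‖ₑ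
          ≤ ∫⁻ t, ‖g t * φ (x + r • y - t)‖ₑ := enorm_integral_le_lintegral_enorm _
        _ ≤ ∫⁻ t in ball x (2 * ε), ‖g t‖ₑ * (2 ^ n / volume (ball x ε)) := by
            rw [← lintegral_indicator measurableSet_ball]
            refine lintegral_mono fun t => ?_
            by_cases ht : t ∈ ball x (2 * ε)
            · rw [indicator_of_mem ht, enorm_mul]
              gcongr
              exact hφle _
            · rw [hsupp, mul_zero, enorm_zero]
              · exact zero_le
              · intro hcon
                refine ht ?_
                rw [mem_ball_zero_iff] at hcon hy
                rw [mem_ball_iff_norm]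
                calc ‖t - x‖ = ‖r • y - (x + r • y - t)‖ := by congr 1; abel
                  _ ≤ ‖r • y‖ + ‖x + r • y - t‖ := norm_sub_le _ _
                  _ < ε + ε := by
                      refine add_lt_add_of_le_of_lt ?_ hcon
                      rw [norm_smul, Real.norm_of_nonneg hr]
                      nlinarith [norm_nonneg y]
                  _ = 2 * ε := by ring
        _ = (∫⁻ t in ball x (2 * ε), ‖g t‖ₑ) * (2 ^ n / volume (ball x ε)) :=
            lintegral_mul_const _ hgE
        _ ≤ M * (2 ^ n * volume (ball x ε)) * (2 ^ n / volume (ball x ε)) := by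
            gcongr
            rw [← volume_ball_two_mul x hε0]
            exact setLIntegral_ball_le_maximal _ (mem_ball_self (by positivity))
        _ = M * (2 ^ n * 2 ^ n) * (volume (ball x ε) / volume (ball x ε)) := by
            simp only [div_eq_mul_inv]; ring
        _ = 4 ^ n * M := by
            rw [ENNReal.div_self (measure_ball_pos volume _ hε0).ne' measure_ball_lt_top.ne,
              mul_one, ← mul_pow, mul_comm]
            norm_num
    calc _ ≤ ∫⁻ y in ball (0 : EuclideanSpace ℝ (Fin n)) 1, 4 ^ n * M :=
          setLIntegral_mono' measurableSet_ball hpt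
      _ = _ := by rw [setLIntegral_const]; ring
  · have hr0 : 0 < r := hε0.trans_le hrε
    set M := maximal (fun y => ‖g y‖ₑ) x with hM
    set V := volume (ball (0 : EuclideanSpace ℝ (Fin n)) 1) with hV
    have hinner : ∀ w, ‖φ w‖ₑ * ∫⁻ y in ball (0 : EuclideanSpace ℝ (Fin n)) 1,
        ‖g (x - w + r • y)‖ₑ ≤ ‖φ w‖ₑ * (2 ^ n * V * M) := by
      intro w
      by_cases hw : w ∈ ball (0 : EuclideanSpace ℝ (Fin n)) ε
      · gcongr
        rw [setLIntegral_ball_comp_add_smul hgE _ hr0]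
        have hsub : ball (x - w) r ⊆ ball x (2 * r) := by
          refine ball_subset_ball' ?_
          rw [dist_eq_norm, sub_sub_cancel_left, norm_neg]
          rw [mem_ball_zero_iff] at hw
          linarith
        calc _ ≤ ENNReal.ofReal ((r ^ n)⁻¹) * (M * volume (ball x (2 * r))) := by
              gcongr
              exact (lintegral_mono_set hsub).trans
                (setLIntegral_ball_le_maximal _ (mem_ball_self (by positivity)))
          _ = ENNReal.ofReal ((r ^ n)⁻¹) * ENNReal.ofReal (r ^ n) * (2 ^ n * V * M) := by
              rw [volume_ball_two_mul x hr0, Measure.addHaar_ball_of_pos _ _ hr0,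
                finrank_euclideanSpace_fin]
              ring
          _ = 2 ^ n * V * M := by
              rw [← ENNReal.ofReal_mul (by positivity), inv_mul_cancel₀ (by positivity),
                ENNReal.ofReal_one, one_mul]
      · rw [hsupp w hw]; simp
    have hφint : ∫⁻ w, ‖φ w‖ₑ = 1 := by
      have h1 := ofReal_integral_eq_lintegral_ofReal (b.integrable_normed (μ := volume))
        (Eventually.of_forall fun z => b.nonneg_normed z)
      rw [b.integral_normed, ENNReal.ofReal_one] at h1
      rw [h1]
      exact lintegral_congr fun z => Real.enorm_eq_ofReal (b.nonneg_normed z)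
    calc ∫⁻ y in ball (0 : EuclideanSpace ℝ (Fin n)) 1,
          ‖convolution g φ (ContinuousLinearMap.lsmul ℝ ℝ) volume (x + r • y)‖ₑ
        ≤ ∫⁻ y in ball (0 : EuclideanSpace ℝ (Fin n)) 1,
            ∫⁻ w, ‖φ w‖ₑ * ‖g (x - w + r • y)‖ₑ := by
          refine lintegral_mono fun y => ?_
          refine (enorm_integral_le_lintegral_enorm _).trans_eq ?_
          rw [← lintegral_sub_left_eq_self _ (x + r • y)]
          refine lintegral_congr fun w => ?_
          simp only [ContinuousLinearMap.lsmul_apply, smul_eq_mul, sub_sub_cancel]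
          rw [enorm_mul, mul_comm, add_sub_right_comm]
      _ = ∫⁻ w, ∫⁻ y in ball (0 : EuclideanSpace ℝ (Fin n)) 1,
            ‖φ w‖ₑ * ‖g (x - w + r • y)‖ₑ := by
          refine lintegral_lintegral_swap (Measurable.aemeasurable ?_)
          exact (hφm.comp measurable_snd).mul (hgE.comp
            ((measurable_snd.const_sub x).add (measurable_fst.const_smul r)))
      _ = ∫⁻ w, ‖φ w‖ₑ * ∫⁻ y in ball (0 : EuclideanSpace ℝ (Fin n)) 1, ‖g (x - w + r • y)‖ₑ :=
          lintegral_congr fun w => lintegral_const_mul' _ _ enorm_ne_top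
      _ ≤ ∫⁻ w, ‖φ w‖ₑ * (2 ^ n * V * M) := lintegral_mono hinner
      _ = 2 ^ n * V * M := by rw [lintegral_mul_const _ hφm, hφint, one_mul]
      _ ≤ 4 ^ n * V * M := by gcongr; norm_num

theorem maximal_mono {n : ℕ} {f g : EuclideanSpace ℝ (Fin n) → ℝ≥0∞} (h : ∀ x, f x ≤ g x)
    (x : EuclideanSpace ℝ (Fin n)) : maximal f x ≤ maximal g x :=
  iSup₂_mono fun _ _ => ENNReal.div_le_div_right (lintegral_mono h) _

/-- The pointwise interpolation inequality between the maximal functions of `u` and of its weak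
gradient of order `j + m`. -/
theorem exists_enorm_weakGrad_le (n j m : ℕ) : ∃ c : ℝ≥0, 0 < c ∧
    ∀ (u : EuclideanSpace ℝ (Fin n) → ℝ)
      (gj : EuclideanSpace ℝ (Fin n) → EuclideanSpace ℝ (Fin j → Fin n))
      (gk : EuclideanSpace ℝ (Fin n) → EuclideanSpace ℝ (Fin (j + m) → Fin n)),
      LocallyIntegrable u volume → HasWeakGrad j u gj → HasWeakGrad (j + m) u gk →
      ∀ᵐ x, ∀ h : ℝ≥0, 0 < h → ‖gj x‖ₑ ≤
        c * (maximal (fun y => ‖u y‖ₑ) x / (h : ℝ≥0∞) ^ j +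
          (h : ℝ≥0∞) ^ m * maximal (fun y => ‖gk y‖ₑ) x) := by
  obtain ⟨c, hc0, hc⟩ := exists_abs_iteratedFDeriv_le n j m
  lift c to ℝ≥0 using hc0.le
  have hc0' : 0 < c := by exact_mod_cast hc0
  set D := 4 ^ n * volume (ball (0 : EuclideanSpace ℝ (Fin n)) 1) with hD
  have hDtop : D ≠ ⊤ := ENNReal.mul_ne_top (by simp) measure_ball_lt_top.ne
  set L : ℝ≥0 := ((Fintype.card (Fin j → Fin n) : ℕ) : ℝ≥0) with hL
  -- The summand 1 makes the constant positive, so that the right-hand side is infinite as soon as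
  -- one maximal function is.
  refine ⟨L * c * D.toNNReal + 1, by positivity, fun u gj gk hu hgj hgk => ?_⟩
  let b : ℕ → ContDiffBump (0 : EuclideanSpace ℝ (Fin n)) := fun i =>
    ⟨1 / ((i : ℝ) + 1), 2 * (1 / ((i : ℝ) + 1)), by positivity, by
      have : (0 : ℝ) < 1 / ((i : ℝ) + 1) := by positivity
      linarith⟩
  have hbout : Tendsto (fun i => (b i).rOut) atTop (𝓝 0) := by
    have h1 := (tendsto_one_div_add_atTop_nhds_zero_nat (𝕜 := ℝ)).const_mul 2
    rw [mul_zero] at h1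
    exact h1
  -- Lebesgue differentiation; the exceptional null set does not depend on h, so h may later be
  -- chosen depending on x.
  have hconv : ∀ᵐ x, ∀ α, Tendsto (fun i => convolution (fun y => gj y α) ((b i).normed volume)
      (ContinuousLinearMap.lsmul ℝ ℝ) volume x) atTop (𝓝 (gj x α)) := by
    rw [ae_all_iff]
    intro α
    have h1 := ContDiffBump.ae_convolution_tendsto_right_of_locallyIntegrable (μ := volume)
      (φ := b) (K := 2) hbout (Eventually.of_forall fun i => le_rfl)
      (hgj.locallyIntegrable_apply α)
    filter_upwards [h1] with x hx
    refine hx.congr fun i => ?_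
    rw [convolution_lsmul_swap, convolution]
    refine integral_congr_ae (Eventually.of_forall fun t => ?_)
    simp [mul_comm]
  filter_upwards [hconv] with x hx h hh
  set Mu := maximal (fun y => ‖u y‖ₑ) x with hMu
  set Mg := maximal (fun y => ‖gk y‖ₑ) x with hMg
  have hh0 : (h : ℝ≥0∞) ≠ 0 := by simpa using hh.ne'
  have hcoe0 : ((L * c * D.toNNReal + 1 : ℝ≥0) : ℝ≥0∞) ≠ 0 := by positivity
  by_cases hMu' : Mu = ⊤
  · rw [hMu', ENNReal.top_div_of_ne_top (by simp), top_add, ENNReal.mul_top hcoe0]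
    exact le_top
  by_cases hMg' : Mg = ⊤
  · rw [hMg', ENNReal.mul_top (pow_ne_zero _ hh0), add_top, ENNReal.mul_top hcoe0]
    exact le_top
  have hreal : ∀ {f : EuclideanSpace ℝ (Fin n) → ℝ} {M : ℝ≥0∞}, M ≠ ⊤ → Continuous f →
      ∫⁻ y in ball (0 : EuclideanSpace ℝ (Fin n)) 1, ‖f y‖ₑ ≤ M →
      ∫ y in ball (0 : EuclideanSpace ℝ (Fin n)) 1, |f y| ≤ M.toReal := by
    intro f M hM hf h
    have := integral_norm_eq_lintegral_enorm (μ := volume.restrict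
      (ball (0 : EuclideanSpace ℝ (Fin n)) 1)) hf.aestronglyMeasurable
    simp only [Real.norm_eq_abs] at this
    rw [this]
    exact ENNReal.toReal_mono hM h
  have hbound : ∀ (α : Fin j → Fin n) (i : ℕ), |convolution (fun y => gj y α) ((b i).normed volume)
      (ContinuousLinearMap.lsmul ℝ ℝ) volume x| ≤
      c * ((D * Mu).toReal / h ^ j + h ^ m * (D * Mg).toReal) := by
    intro α i
    have hφ : ContDiff ℝ ∞ ((b i).normed volume) := (b i).contDiff_normed
    have hφc : HasCompactSupport ((b i).normed volume) := (b i).hasCompactSupport_normed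
    rw [← hgj.iteratedFDeriv_convolution hu hφ hφc]
    have hU : ContDiff ℝ ∞ (convolution u ((b i).normed volume)
      (ContinuousLinearMap.lsmul ℝ ℝ) volume) := hφc.contDiff_convolution_right _ hu hφ
    refine hc _ x _ _ hU ENNReal.toReal_nonneg (fun r hr => ?_) (fun r hr β => ?_) α h
      (by exact_mod_cast hh)
    · exact hreal (f := fun y => convolution u ((b i).normed volume)
        (ContinuousLinearMap.lsmul ℝ ℝ) volume (x + r • y)) (ENNReal.mul_ne_top hDtop hMu')
        (hU.continuous.comp (by fun_prop))
        (setLIntegral_convolution_le_maximal hu.aestronglyMeasurable (b i) le_rfl x hr.le)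
    · refine hreal (f := fun y => iteratedFDeriv ℝ (j + m) (convolution u ((b i).normed volume)
        (ContinuousLinearMap.lsmul ℝ ℝ) volume) (x + r • y)
          fun i => EuclideanSpace.single (β i) 1) (ENNReal.mul_ne_top hDtop hMg')
        ((contDiff_iteratedFDeriv_apply hU _ _).continuous.comp (by fun_prop)) ?_
      simp only [hgk.iteratedFDeriv_convolution hu hφ hφc]
      refine (setLIntegral_convolution_le_maximal
        (hgk.locallyIntegrable_apply β).aestronglyMeasurable (b i) le_rfl x hr).trans ?_
      gcongr
      refine maximal_mono (fun y => ?_) x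
      exact enorm_le_iff_norm_le.2 (PiLp.norm_apply_le (gk y) β)
  have hlim : ∀ α, |gj x α| ≤ c * ((D * Mu).toReal / h ^ j + h ^ m * (D * Mg).toReal) := fun α =>
    le_of_tendsto (hx α).abs (Eventually.of_forall (hbound α))
  have hnorm : ‖gj x‖ ≤ L * (c * ((D * Mu).toReal / h ^ j + h ^ m * (D * Mg).toReal)) := by
    have hsum : ‖gj x‖ ≤ ∑ α, |gj x α| := by
      have hexp : gj x = ∑ α, gj x α • EuclideanSpace.single α (1 : ℝ) := by
        ext β
        simp [Pi.single_apply]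
      conv_lhs => rw [hexp]
      refine (norm_sum_le _ _).trans_eq (Finset.sum_congr rfl fun α _ => ?_)
      simp [norm_smul]
    refine hsum.trans ((Finset.sum_le_sum fun α _ => hlim α).trans_eq ?_)
    simp [hL]
  clear_value Mu Mg D
  lift Mu to ℝ≥0 using hMu'
  lift Mg to ℝ≥0 using hMg'
  lift D to ℝ≥0 using hDtop
  simp only [← ENNReal.coe_mul, ENNReal.coe_toReal, ENNReal.toNNReal_coe] at hnorm ⊢
  have hfin : ‖gj x‖₊ ≤ (L * c * D + 1) * (Mu / h ^ j + h ^ m * Mg) := by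
    have h1 : ‖gj x‖₊ ≤ L * (c * ((D * Mu) / h ^ j + h ^ m * (D * Mg))) := by
      rw [← NNReal.coe_le_coe]
      push_cast
      exact_mod_cast hnorm
    refine h1.trans ?_
    calc L * (c * ((D * Mu) / h ^ j + h ^ m * (D * Mg)))
        = (L * c * D) * (Mu / h ^ j + h ^ m * Mg) := by ring
      _ ≤ _ := by gcongr; exact le_self_add
  have := ENNReal.coe_le_coe.2 hfin
  rw [← enorm_eq_nnnorm] at this
  refine this.trans_eq ?_
  rw [ENNReal.coe_mul, ENNReal.coe_add (Mu / h ^ j), ENNReal.coe_div (by positivity)]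
  push_cast
  rfl

/-! ### From the pointwise inequality to norm inequalities -/

/-- The only place where the condition on the inverses is applied. It replaces Hölder's inequality
in Orlicz spaces and acts pointwise. -/
theorem IsYoung.extend_le_add_of_interpolation {A B C : ℝ≥0 → ℝ≥0} (hA : IsYoung A)
    (hB : IsYoung B) (hC : IsYoung C) {j m : ℕ} (hk : 0 < j + m) {K : ℝ≥0} (hK0 : 0 < K)
    (hK : ∀ t : ℝ≥0, 0 < t → inverse B t ^ ((j : ℝ) / (j + m : ℕ)) *
      inverse C t ^ (1 - (j : ℝ) / (j + m : ℕ)) ≤ K * inverse A t)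
    {c β γ : ℝ≥0} (hc : 0 < c) (hβ : 0 < β) (hγ : 0 < γ) {G Mu Mg : ℝ≥0∞}
    (h : ∀ r : ℝ≥0, 0 < r → G ≤ c * (Mu / (r : ℝ≥0∞) ^ j + (r : ℝ≥0∞) ^ m * Mg)) :
    extend A (G / ((2 * c * K * (β ^ ((j : ℝ) / (j + m : ℕ)) *
      γ ^ (1 - (j : ℝ) / (j + m : ℕ))) : ℝ≥0) : ℝ≥0∞)) ≤
      extend B (Mg / β) + extend C (Mu / γ) := by
  by_cases hMg : Mg = ⊤
  · simp [hMg, ENNReal.top_div_of_ne_top]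
  by_cases hMu : Mu = ⊤
  · simp [hMu, ENNReal.top_div_of_ne_top]
  lift Mg to ℝ≥0 using hMg
  lift Mu to ℝ≥0 using hMu
  have hG : G ≠ ⊤ := by
    refine ne_top_of_le_ne_top ?_ (h 1 one_pos)
    simp only [ENNReal.coe_one, one_pow, div_one, one_mul, ← ENNReal.coe_add, ← ENNReal.coe_mul]
    exact ENNReal.coe_ne_top
  lift G to ℝ≥0 using hG
  have h' : ∀ r : ℝ≥0, 0 < r → G ≤ c * (Mu / r ^ j + r ^ m * Mg) := by
    intro r hr
    have h1 := h r hr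
    rw [← ENNReal.coe_pow, ← ENNReal.coe_div (by positivity), ← ENNReal.coe_pow] at h1
    exact_mod_cast h1
  set θ : ℝ := (j : ℝ) / (j + m : ℕ) with hθ
  have hkR : (0 : ℝ) < ((j + m : ℕ) : ℝ) := by exact_mod_cast hk
  have hθm : 1 - θ = (m : ℝ) / (j + m : ℕ) := by
    rw [hθ, eq_div_iff hkR.ne', sub_mul, div_mul_cancel₀ _ hkR.ne']
    push_cast
    ring
  set Λ := 2 * c * K * (β ^ θ * γ ^ (1 - θ)) with hΛ
  have hΛ0 : 0 < Λ := by
    have := NNReal.rpow_pos (p := θ) hβ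
    have := NNReal.rpow_pos (p := 1 - θ) hγ
    positivity
  rw [← ENNReal.coe_div hΛ0.ne', ← ENNReal.coe_div hβ.ne', ← ENNReal.coe_div hγ.ne', extend_coe,
    extend_coe, extend_coe, ← ENNReal.coe_add, ENNReal.coe_le_coe]
  set t := max (B (Mg / β)) (C (Mu / γ)) with ht
  refine le_trans ?_ (max_le_add_of_nonneg zero_le zero_le : t ≤ _)
  rcases (zero_le (a := t)).eq_or_lt with ht0 | ht0
  · have hb : Mg = 0 := by
      by_contra hne
      have : 0 < Mg / β := div_pos (pos_iff_ne_zero.2 hne) hβ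
      exact absurd ((hB.map_pos this).trans_le (le_max_left _ _)) (by rw [← ht, ← ht0]; simp)
    have hg : Mu = 0 := by
      by_contra hne
      have : 0 < Mu / γ := div_pos (pos_iff_ne_zero.2 hne) hγ
      exact absurd ((hC.map_pos this).trans_le (le_max_right _ _)) (by rw [← ht, ← ht0]; simp)
    have hG0 : G = 0 := by
      have := h' 1 one_pos
      simpa [hb, hg] using this
    simp [hG0, hA.map_zero]
  · have hb0 := hB.inverse_pos ht0
    have hg0 := hC.inverse_pos ht0
    set b := inverse B t with hb
    set g := inverse C t with hg
    have hMgb : Mg ≤ β * b := by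
      rw [← div_le_iff₀' hβ, ← hB.strictMono.le_iff_le, hb, hB.map_inverse]
      exact le_max_left _ _
    have hMug : Mu ≤ γ * g := by
      rw [← div_le_iff₀' hγ, ← hC.strictMono.le_iff_le, hg, hC.map_inverse]
      exact le_max_right _ _
    set p := γ * g with hp
    set q := β * b with hq
    have hp0 : 0 < p := mul_pos hγ hg0
    have hq0 : 0 < q := mul_pos hβ hb0
    have hpq0 : 0 < p / q := div_pos hp0 hq0
    -- The radius that balances the two terms: p / rʲ = rᵐ q, both equal to q^θ p^(1-θ). The equal
    -- terms account for the factor 2 in Λ.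
    set r := (p / q) ^ ((1 : ℝ) / (j + m : ℕ)) with hr
    have hr0 : 0 < r := NNReal.rpow_pos hpq0
    have hrj : r ^ j = (p / q) ^ θ := by
      rw [hr, ← NNReal.rpow_natCast, ← NNReal.rpow_mul, hθ]
      congr 1
      ring
    have hrm : r ^ m = (p / q) ^ (1 - θ) := by
      rw [hr, ← NNReal.rpow_natCast, ← NNReal.rpow_mul, hθm]
      congr 1
      ring
    have e1 : p / r ^ j = q ^ θ * p ^ (1 - θ) := by
      rw [hrj, NNReal.div_rpow, NNReal.rpow_sub hp0.ne', NNReal.rpow_one]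
      have := (NNReal.rpow_pos (p := θ) hp0).ne'
      have := (NNReal.rpow_pos (p := θ) hq0).ne'
      field_simp
    have e2 : r ^ m * q = q ^ θ * p ^ (1 - θ) := by
      rw [hrm, NNReal.div_rpow, NNReal.rpow_sub hq0.ne', NNReal.rpow_one]
      have := (NNReal.rpow_pos (p := θ) hq0).ne'
      field_simp
    have hGle : G ≤ Λ * inverse A t := by
      calc G ≤ c * (Mu / r ^ j + r ^ m * Mg) := h' r hr0
        _ ≤ c * (p / r ^ j + r ^ m * q) := by gcongr
        _ = 2 * c * (β ^ θ * γ ^ (1 - θ)) * (b ^ θ * g ^ (1 - θ)) := by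
            rw [e1, e2, hp, hq, NNReal.mul_rpow, NNReal.mul_rpow]
            ring
        _ ≤ 2 * c * (β ^ θ * γ ^ (1 - θ)) * (K * inverse A t) := by
            exact mul_le_mul_right (hK t ht0) _
        _ = Λ * inverse A t := by rw [hΛ]; ring
    calc A (G / Λ) ≤ A (inverse A t) :=
          hA.strictMono.monotone ((div_le_iff₀' hΛ0).2 hGle)
      _ = t := hA.map_inverse t

/-! ### Vanishing norms, and passage to the limit in the constants -/

/-- Convexity gives C(f) ≤ C((N + 1) f) / (N + 1), so the modular of f is at most D / (N + 1) for
every N. -/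
theorem IsYoung.ae_eq_zero_of_forall_modular_le {C : ℝ≥0 → ℝ≥0} (hC : IsYoung C) {α : Type*}
    [MeasurableSpace α] {μ : Measure α} {f : α → ℝ≥0∞} (hf : AEMeasurable f μ) {D : ℝ≥0}
    (h : ∀ l : ℝ≥0, 0 < l → modular C μ (fun x => f x / (l : ℝ≥0∞)) ≤ D) : f =ᵐ[μ] 0 := by
  have hle : ∀ N : ℕ, modular C μ f ≤ D / ((N + 1 : ℕ) : ℝ≥0∞) := by
    intro N
    have hN0 : ((N + 1 : ℕ) : ℝ≥0) ≠ 0 := by positivity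
    have hN1 : (1 : ℝ≥0) ≤ ((N + 1 : ℕ) : ℝ≥0) := by simp
    calc modular C μ f
        ≤ ∫⁻ x, extend C (f x / (((N + 1 : ℕ) : ℝ≥0)⁻¹ : ℝ≥0)) / ((N + 1 : ℕ) : ℝ≥0) ∂μ := by
          refine lintegral_mono fun x => ?_
          have h1 := hC.extend_div_le hN1 (f x / (((N + 1 : ℕ) : ℝ≥0)⁻¹ : ℝ≥0))
          refine le_trans (le_of_eq ?_) h1
          congr 1
          rw [ENNReal.coe_inv hN0, div_eq_mul_inv, div_eq_mul_inv, inv_inv, mul_assoc,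
            ENNReal.mul_inv_cancel (by simp) ENNReal.coe_ne_top, mul_one]
      _ = modular C μ (fun x => f x / (((N + 1 : ℕ) : ℝ≥0)⁻¹ : ℝ≥0)) / ((N + 1 : ℕ) : ℝ≥0) := by
          simp only [div_eq_mul_inv]
          rw [lintegral_mul_const' _ _ (by simp)]
          rfl
      _ ≤ _ := by
          rw [ENNReal.coe_natCast]
          gcongr
          exact h _ (by positivity)
  have hzero : modular C μ f = 0 := by
    refine le_antisymm (ge_of_tendsto' (x := atTop) ?_ hle) zero_le
    have h1 : Tendsto (fun N : ℕ => (D : ℝ≥0∞) / (N : ℝ≥0∞)) atTop (𝓝 0) := by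
      have h2 := ENNReal.Tendsto.const_mul ENNReal.tendsto_inv_nat_nhds_zero
        (Or.inr (ENNReal.coe_ne_top (r := D)))
      rwa [mul_zero] at h2
    exact (tendsto_add_atTop_iff_nat 1).2 h1
  have hae := (lintegral_eq_zero_iff' (hC.measurable_extend.comp_aemeasurable hf)).1 hzero
  exact hae.mono fun x hx => hC.extend_eq_zero hx

/-- One zero of the maximal function is enough: f then has integral 0 over every ball around that
point. -/
theorem ae_eq_zero_of_maximal_ae_eq_zero {n : ℕ} {f : EuclideanSpace ℝ (Fin n) → ℝ≥0∞}
    (hf : AEMeasurable f) (h : maximal f =ᵐ[volume] 0) : f =ᵐ[volume] 0 := by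
  obtain ⟨x, hx⟩ := h.exists
  have hball : ∀ N : ℕ, ∫⁻ y in ball x (N + 1), f y = 0 := fun N => by
    have h1 := setLIntegral_ball_le_maximal f (x := x) (c := x) (r := N + 1)
      (mem_ball_self (by positivity))
    rw [hx] at h1
    simpa using h1
  have hU : (⋃ N : ℕ, ball x ((N : ℝ) + 1)) = univ := by
    refine eq_univ_of_forall fun y => mem_iUnion.2 ?_
    obtain ⟨N, hN⟩ := exists_nat_gt (dist y x)
    exact ⟨N, by rw [mem_ball]; linarith⟩
  rw [← Measure.restrict_univ (μ := volume), ← hU]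
  exact (ae_restrict_iUnion_iff _ _).2 fun N => (lintegral_eq_zero_iff' hf.restrict).1 (hball N)

theorem HasWeakGrad.ae_eq_zero {n m : ℕ} {u : EuclideanSpace ℝ (Fin n) → ℝ}
    {v : EuclideanSpace ℝ (Fin n) → EuclideanSpace ℝ (Fin m → Fin n)} (h : HasWeakGrad m u v)
    (hu : u =ᵐ[volume] 0) : v =ᵐ[volume] 0 := by
  have hα : ∀ α, ∀ᵐ x, v x α = 0 := fun α => by
    refine ae_eq_zero_of_integral_contDiff_smul_eq_zero (h.locallyIntegrable_apply α)
      fun φ hφ hc => ?_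
    have h1 := h.2 φ hφ hc α
    have h2 : ∫ x, u x * iteratedFDeriv ℝ m φ x
        (fun i => EuclideanSpace.single (α i) (1 : ℝ)) = 0 := by
      rw [integral_eq_zero_of_ae]
      filter_upwards [hu] with x hx
      simp [hx]
    rw [h2, eq_comm, mul_eq_zero] at h1
    simpa [mul_comm] using h1.resolve_left (by simp)
  filter_upwards [ae_all_iff.2 hα] with x hx
  ext α
  simpa using hx α

/-- For finite X and Y one lets β ↓ X and γ ↓ Y. The case Y = 0 is a separate hypothesis: with X = ∞
no β is available, while ∞ · 0 = 0 in `ℝ≥0∞` makes the right-hand side vanish. -/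
theorem le_mul_rpow_of_forall_lt {X Y Z : ℝ≥0∞} {K : ℝ≥0} (hK : 0 < K) {p q : ℝ}
    (hp : 0 < p) (hq : 0 < q)
    (h : ∀ β γ : ℝ≥0, X < β → Y < γ → Z ≤ (K * (β ^ p * γ ^ q) : ℝ≥0))
    (hY : Y = 0 → Z = 0) (hXY : X ≠ 0 ∨ Y ≠ ⊤) : Z ≤ K * (X ^ p * Y ^ q) := by
  have hK' : (K : ℝ≥0∞) ≠ 0 := by simpa using hK.ne'
  by_cases hY0 : Y = 0
  · simp [hY hY0]
  by_cases hX : X = ⊤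
  · rw [hX, ENNReal.top_rpow_of_pos hp, ENNReal.top_mul, ENNReal.mul_top hK']
    · exact le_top
    · simp [ENNReal.rpow_eq_zero_iff, hY0, hq.not_gt]
  by_cases hYt : Y = ⊤
  · have hX0 : X ≠ 0 := hXY.resolve_right (by simp [hYt])
    rw [hYt, ENNReal.top_rpow_of_pos hq, ENNReal.mul_top, ENNReal.mul_top hK']
    · exact le_top
    · simp [ENNReal.rpow_eq_zero_iff, hX0, hp.not_gt]
  lift X to ℝ≥0 using hX
  lift Y to ℝ≥0 using hYt
  rw [← ENNReal.coe_rpow_of_nonneg _ hp.le, ← ENNReal.coe_rpow_of_nonneg _ hq.le,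
    ← ENNReal.coe_mul, ← ENNReal.coe_mul]
  have hcont : Continuous fun ε : ℝ≥0 => K * ((X + ε) ^ p * (Y + ε) ^ q) := by
    have h1 : Continuous fun ε : ℝ≥0 => (X + ε) ^ p :=
      (NNReal.continuous_rpow_const hp.le).comp (by fun_prop)
    have h2 : Continuous fun ε : ℝ≥0 => (Y + ε) ^ q :=
      (NNReal.continuous_rpow_const hq.le).comp (by fun_prop)
    exact continuous_const.mul (h1.mul h2)
  have hlim : Tendsto (fun ε : ℝ≥0 => ((K * ((X + ε) ^ p * (Y + ε) ^ q) : ℝ≥0) : ℝ≥0∞)) (𝓝[>] 0)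
      (𝓝 ((K * (X ^ p * Y ^ q) : ℝ≥0) : ℝ≥0∞)) := by
    have h3 := (ENNReal.continuous_coe.comp hcont).tendsto 0
    simp only [Function.comp_def, add_zero] at h3
    exact h3.mono_left nhdsWithin_le_nhds
  refine ge_of_tendsto hlim ?_
  filter_upwards [self_mem_nhdsWithin] with ε hε
  refine h _ _ ?_ ?_ <;> exact_mod_cast lt_add_of_pos_right _ hε

/-- The interpolation inequality for any two functionals which control the modulars of maximal
functions. -/
theorem exists_interpolation_of_modular_maximal_le {n j k : ℕ} (hj : 1 ≤ j) (hjk : j < k)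
    {A B C : ℝ≥0 → ℝ≥0} (hA : IsYoung A) (hB : IsYoung B) (hC : IsYoung C)
    (hcond : InverseCondition j k A B C) {X Y : (EuclideanSpace ℝ (Fin n) → ℝ≥0∞) → ℝ≥0∞}
    {p q D : ℝ≥0} (hp : 0 < p) (hq : 0 < q)
    (hX : ∀ f, AEMeasurable f → ∀ l : ℝ≥0, X f < l →
      modular B volume (fun x => maximal f x / ((p * l : ℝ≥0) : ℝ≥0∞)) ≤ D)
    (hY : ∀ f, AEMeasurable f → ∀ l : ℝ≥0, Y f < l →
      modular C volume (fun x => maximal f x / ((q * l : ℝ≥0) : ℝ≥0∞)) ≤ D) :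
    ∃ K : ℝ≥0, ∀ u : EuclideanSpace ℝ (Fin n) → ℝ, WeaklyDifferentiable k u →
      ∀ gj gk, HasWeakGrad j u gj → HasWeakGrad k u gk →
        (X (fun x => ‖gk x‖ₑ) ≠ 0 ∨ Y (fun x => ‖u x‖ₑ) ≠ ⊤) →
        luxemburg A volume (fun x => ‖gj x‖ₑ) ≤ K * (X (fun x => ‖gk x‖ₑ) ^ ((j : ℝ) / k) *
          Y (fun x => ‖u x‖ₑ) ^ (1 - (j : ℝ) / k)) := by
  obtain ⟨m, rfl⟩ := Nat.exists_eq_add_of_le hjk.le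
  obtain ⟨K, hK⟩ := hcond
  obtain ⟨c, hc0, hc⟩ := exists_enorm_weakGrad_le n j m
  set θ : ℝ := (j : ℝ) / (j + m : ℕ) with hθ
  have hkR : (0 : ℝ) < ((j + m : ℕ) : ℝ) := by exact_mod_cast (by omega : 0 < j + m)
  have hθ0 : 0 < θ := div_pos (by exact_mod_cast hj) hkR
  have hθ1 : 0 < 1 - θ := by
    rw [sub_pos, hθ, div_lt_one hkR]
    exact_mod_cast hjk
  set K' := K + 1 with hK'
  have hKK' : ∀ t : ℝ≥0, 0 < t → inverse B t ^ θ * inverse C t ^ (1 - θ) ≤ K' * inverse A t :=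
    fun t ht => (hK t ht).trans (by gcongr; exact le_self_add)
  -- The two modulars contribute 2D; the summand 1 ensures D' ≥ 1, as the passage from modular to
  -- norm requires.
  set D' := 2 * D + 1 with hD'
  have hpθ := NNReal.rpow_pos (p := θ) hp
  have hqθ := NNReal.rpow_pos (p := 1 - θ) hq
  refine ⟨D' * (2 * c * K' * (p ^ θ * q ^ (1 - θ))), fun u hu gj gk hgj hgk hXY => ?_⟩
  have hum : AEMeasurable fun x => ‖u x‖ₑ := hu.1.aestronglyMeasurable.enorm
  have hgm : AEMeasurable fun x => ‖gk x‖ₑ := hgk.1.aestronglyMeasurable.enorm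
  refine le_mul_rpow_of_forall_lt (by positivity) hθ0 hθ1 (fun β γ hβ hγ => ?_)
    (fun hY0 => ?_) hXY
  · have hβ0 : 0 < β := by exact_mod_cast lt_of_le_of_lt zero_le hβ
    have hγ0 : 0 < γ := by exact_mod_cast lt_of_le_of_lt zero_le hγ
    have hβθ := NNReal.rpow_pos (p := θ) hβ0
    have hγθ := NNReal.rpow_pos (p := 1 - θ) hγ0
    have hpβ : 0 < p * β := mul_pos hp hβ0
    have hqγ : 0 < q * γ := mul_pos hq hγ0
    have h1 : modular A volume (fun x => ‖gj x‖ₑ /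
        ((2 * c * K' * ((p * β) ^ θ * (q * γ) ^ (1 - θ)) : ℝ≥0) : ℝ≥0∞)) ≤ D' := by
      calc _ ≤ ∫⁻ x, (extend B (maximal (fun y => ‖gk y‖ₑ) x / ((p * β : ℝ≥0) : ℝ≥0∞)) +
            extend C (maximal (fun y => ‖u y‖ₑ) x / ((q * γ : ℝ≥0) : ℝ≥0∞))) := by
            refine lintegral_mono_ae ?_
            filter_upwards [hc u gj gk hu.1 hgj hgk] with x hx
            exact hA.extend_le_add_of_interpolation hB hC (by omega) (by positivity) hKK' hc0 hpβ
              hqγ hx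
        _ = modular B volume (fun x => maximal (fun y => ‖gk y‖ₑ) x / ((p * β : ℝ≥0) : ℝ≥0∞)) +
            modular C volume (fun x => maximal (fun y => ‖u y‖ₑ) x / ((q * γ : ℝ≥0) : ℝ≥0∞)) :=
            lintegral_add_left
              (hB.measurable_extend.comp ((measurable_maximal _).div_const _)) _
        _ ≤ D + D := add_le_add (hX _ hgm β hβ) (hY _ hum γ hγ)
        _ ≤ D' := by
            rw [← ENNReal.coe_add, ENNReal.coe_le_coe, hD', two_mul]
            exact le_self_add
    have h2 := hA.luxemburg_le_of_modular_le (by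
      have := NNReal.rpow_pos (p := θ) hpβ
      have := NNReal.rpow_pos (p := 1 - θ) hqγ
      positivity) (by rw [hD']; exact le_add_self) h1
    refine h2.trans_eq ?_
    rw [NNReal.mul_rpow, NNReal.mul_rpow]
    congr 1
    ring
  -- When Y vanishes on u, the maximal function of u has bounded modular at every scale, so it is
  -- zero almost everywhere; then u, and with it its weak gradient, vanishes.
  · refine hA.luxemburg_eq_zero_of_ae_eq_zero ?_
    have hM : maximal (fun x => ‖u x‖ₑ) =ᵐ[volume] 0 := by
      refine hC.ae_eq_zero_of_forall_modular_le (measurable_maximal _).aemeasurable (D := D)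
        fun l hl => ?_
      have h1 := hY _ hum (l / q) (by rw [hY0]; exact_mod_cast div_pos hl hq)
      rwa [mul_div_cancel₀ _ hq.ne'] at h1
    have hu0 : u =ᵐ[volume] 0 :=
      (ae_eq_zero_of_maximal_ae_eq_zero hum hM).mono fun x hx => by simpa using hx
    exact (hgj.ae_eq_zero hu0).mono fun x hx => by simp [hx]

/-! ### Sufficiency: assertions (a) and (b) -/

theorem maximalInequality_of_inverseCondition {n j k : ℕ} (hn : 1 ≤ n) (hj : 1 ≤ j) (hjk : j < k)
    {A B C : ℝ≥0 → ℝ≥0} (hA : IsYoung A) (hB : IsYoung B) (hC : IsYoung C)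
    (hcond : InverseCondition j k A B C) : MaximalInequality n j k A B C := by
  have key : ∀ {B : ℝ≥0 → ℝ≥0}, IsYoung B → ∀ f : EuclideanSpace ℝ (Fin n) → ℝ≥0∞,
      AEMeasurable f → ∀ l : ℝ≥0, luxemburg B halfLine (maxRearr volume f) < l →
      modular B volume (fun x => maximal f x / ((2 * l : ℝ≥0) : ℝ≥0∞)) ≤ (5 ^ n : ℝ≥0) := by
    intro B hB f hf l hl
    have hl0 : 0 < l := by exact_mod_cast lt_of_le_of_lt zero_le hl
    calc _ ≤ 5 ^ n * modular B halfLine (fun t => maxRearr volume f t / (l : ℝ≥0∞)) :=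
          hB.modular_maximal_le_modular_maxRearr hn hf hl0
      _ ≤ 5 ^ n * 1 := by
          gcongr
          exact hB.modular_le_one_of_luxemburg_lt hl
      _ = _ := by simp
  exact exists_interpolation_of_modular_maximal_le hj hjk hA hB hC hcond two_pos two_pos
    (X := fun f => luxemburg B halfLine (maxRearr volume f))
    (Y := fun f => luxemburg C halfLine (maxRearr volume f)) (key hB) (key hC)

theorem IsYoung.exists_modular_maximal_le_of_upperBoydIndex_lt {B : ℝ≥0 → ℝ≥0} (hB : IsYoung B)
    {n : ℕ} (hn : 1 ≤ n) (h : upperBoydIndex B < 1) :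
    ∃ p D : ℝ≥0, 0 < p ∧ ∀ f : EuclideanSpace ℝ (Fin n) → ℝ≥0∞, AEMeasurable f → ∀ l : ℝ≥0,
      luxemburg B volume f < l →
      modular B volume (fun x => maximal f x / ((p * l : ℝ≥0) : ℝ≥0∞)) ≤ D := by
  obtain ⟨s, a, ha, has, hsa⟩ := hB.exists_mul_le_of_upperBoydIndex_lt h
  have ha0 : 0 < a := zero_lt_one.trans ha
  refine ⟨2 * a, 5 ^ n * (a * (1 - a / s)⁻¹), by positivity, fun f hf l hl => ?_⟩
  have hl0 : 0 < l := by exact_mod_cast lt_of_le_of_lt zero_le hl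
  have h1 := hB.modular_maximal_le hn ha has hsa (hf.div_const (l : ℝ≥0∞))
  have h2 := hB.modular_le_one_of_luxemburg_lt hl
  simp only [maximal_div f hl0] at h1
  have hdiv : ∀ x, maximal f x / ((2 * a * l : ℝ≥0) : ℝ≥0∞) =
      maximal f x / l / ((2 * a : ℝ≥0) : ℝ≥0∞) := fun x => by
    rw [mul_comm, ENNReal.coe_mul, div_eq_mul_inv, ENNReal.mul_inv
      (Or.inl (by simpa using hl0.ne')) (Or.inl ENNReal.coe_ne_top), ← mul_assoc]
    rfl
  simp only [hdiv]
  refine h1.trans ?_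
  calc _ ≤ ((5 ^ n * (a * (1 - a / s)⁻¹) : ℝ≥0) : ℝ≥0∞) * 1 := by gcongr
    _ = _ := mul_one _

theorem plainInequality_of_inverseCondition {n j k : ℕ} (hn : 1 ≤ n) (hj : 1 ≤ j) (hjk : j < k)
    {A B C : ℝ≥0 → ℝ≥0} (hA : IsYoung A) (hB : IsYoung B) (hC : IsYoung C)
    (hcond : InverseCondition j k A B C) (hBi : upperBoydIndex B < 1)
    (hCi : upperBoydIndex C < 1) : PlainInequality n j k A B C := by
  obtain ⟨p, D₁, hp, h₁⟩ := hB.exists_modular_maximal_le_of_upperBoydIndex_lt hn hBi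
  obtain ⟨q, D₂, hq, h₂⟩ := hC.exists_modular_maximal_le_of_upperBoydIndex_lt hn hCi
  exact exists_interpolation_of_modular_maximal_le hj hjk hA hB hC hcond hp hq (D := max D₁ D₂)
    (fun f hf l hl => (h₁ f hf l hl).trans (by exact_mod_cast le_max_left D₁ D₂))
    (fun f hf l hl => (h₂ f hf l hl).trans (by exact_mod_cast le_max_right D₁ D₂))

/-! ### Necessity of the condition -/

section Indicator

variable {α : Type*} [MeasurableSpace α] {μ : Measure α} {A : ℝ≥0 → ℝ≥0} {f : α → ℝ≥0∞} {S : Set α}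
  {s t : ℝ≥0}

/-- A multiple s of the indicator of a set of measure 1 / t has norm s / A⁻¹(t); this and the next
lemma are the two halves of that identity, in the one-sided form used for bumps. -/
theorem IsYoung.luxemburg_le_div_inverse (hA : IsYoung A) (hS : MeasurableSet S) (hs : 0 < s)
    (ht : 0 < t) (hμ : μ S * t ≤ 1) (hf : ∀ x ∈ S, f x ≤ s) (hf0 : ∀ x, x ∉ S → f x = 0) :
    luxemburg A μ f ≤ (s / inverse A t : ℝ≥0) := by
  have hinv := hA.inverse_pos ht
  refine luxemburg_le (div_pos hs hinv) ?_
  calc modular A μ (fun x => f x / ((s / inverse A t : ℝ≥0) : ℝ≥0∞))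
      ≤ ∫⁻ x, S.indicator (fun _ => (t : ℝ≥0∞)) x ∂μ := by
        refine lintegral_mono fun x => ?_
        by_cases hx : x ∈ S
        · rw [indicator_of_mem hx]
          calc extend A (f x / ((s / inverse A t : ℝ≥0) : ℝ≥0∞))
              ≤ extend A ((s : ℝ≥0∞) / ((s / inverse A t : ℝ≥0) : ℝ≥0∞)) :=
                hA.extend_mono (ENNReal.div_le_div_right (hf x hx) _)
            _ = t := by
                rw [← ENNReal.coe_div (div_pos hs hinv).ne', extend_coe, div_div_cancel₀ hs.ne',
                  hA.map_inverse]
        · simp [indicator_of_notMem hx, hf0 x hx, hA.extend_zero]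
    _ = t * μ S := lintegral_indicator_const hS _
    _ ≤ 1 := by rwa [mul_comm]

theorem IsYoung.div_inverse_le_luxemburg (hA : IsYoung A) (hS : MeasurableSet S) (ht : 0 < t)
    (hμ : 1 ≤ μ S * t) (hf : ∀ x ∈ S, s ≤ f x) :
    ((s / inverse A t : ℝ≥0) : ℝ≥0∞) ≤ luxemburg A μ f := by
  have hinv := hA.inverse_pos ht
  refine le_iInf₂ fun l hl => ?_
  have h1 : A (s / l) * μ S ≤ 1 := by
    calc A (s / l) * μ S = ∫⁻ x, S.indicator (fun _ => (A (s / l) : ℝ≥0∞)) x ∂μ :=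
          (lintegral_indicator_const hS _).symm
      _ ≤ modular A μ (fun x => f x / (l : ℝ≥0∞)) := by
          refine lintegral_mono fun x => ?_
          by_cases hx : x ∈ S
          · rw [indicator_of_mem hx, ← extend_coe, ENNReal.coe_div hl.1.ne']
            exact hA.extend_mono (ENNReal.div_le_div_right (hf x hx) _)
          · rw [indicator_of_notMem hx]
            exact zero_le
      _ ≤ 1 := hl.2
  have h2 : A (s / l) ≤ t := by
    have h3 : (A (s / l) : ℝ≥0∞) ≤ t := by
      calc (A (s / l) : ℝ≥0∞) = A (s / l) * 1 := (mul_one _).symm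
        _ ≤ A (s / l) * (μ S * t) := by gcongr
        _ = A (s / l) * μ S * t := (mul_assoc _ _ _).symm
        _ ≤ 1 * t := by gcongr
        _ = t := one_mul _
    exact_mod_cast h3
  rw [← hA.map_inverse t, hA.strictMono.le_iff_le, div_le_iff₀ hl.1, mul_comm,
    ← div_le_iff₀ hinv] at h2
  exact_mod_cast h2

end Indicator

/-- The classical gradient of order `m`. -/
def classicalGrad {n : ℕ} (m : ℕ) (u : EuclideanSpace ℝ (Fin n) → ℝ)
    (x : EuclideanSpace ℝ (Fin n)) : EuclideanSpace ℝ (Fin m → Fin n) :=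
  WithLp.toLp 2 fun α => iteratedFDeriv ℝ m u x fun i => EuclideanSpace.single (α i) (1 : ℝ)

theorem continuous_classicalGrad {n m : ℕ} {u : EuclideanSpace ℝ (Fin n) → ℝ}
    (hu : ContDiff ℝ ∞ u) : Continuous (classicalGrad m u) :=
  (PiLp.continuous_toLp 2 _).comp
    (continuous_pi fun _ => (contDiff_iteratedFDeriv_apply hu m _).continuous)

theorem hasWeakGrad_classicalGrad {n : ℕ} (m : ℕ) {u : EuclideanSpace ℝ (Fin n) → ℝ}
    (hu : ContDiff ℝ ∞ u) : HasWeakGrad m u (classicalGrad m u) :=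
  ⟨(continuous_classicalGrad hu).locallyIntegrable,
    fun _ hφ hc _ => integral_iteratedFDeriv_mul hu hφ hc m _⟩

theorem classicalGrad_comp_smul {n m : ℕ} {u : EuclideanSpace ℝ (Fin n) → ℝ}
    (hu : ContDiff ℝ ∞ u) (a : ℝ) (x : EuclideanSpace ℝ (Fin n)) :
    classicalGrad m (fun y => u (a • y)) x = a ^ m • classicalGrad m u (a • x) := by
  ext α
  have h := iteratedFDeriv_comp_add_smul hu m 0 a (fun i => EuclideanSpace.single (α i) (1 : ℝ)) x
  simp only [zero_add] at h
  simpa [classicalGrad] using h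

theorem classicalGrad_eq_zero_of_notMem_tsupport {n m : ℕ} {u : EuclideanSpace ℝ (Fin n) → ℝ}
    {x : EuclideanSpace ℝ (Fin n)} (hx : x ∉ tsupport u) : classicalGrad m u x = 0 := by
  have h : iteratedFDeriv ℝ m u x = 0 := by
    by_contra hne
    exact hx (support_iteratedFDeriv_subset m hne)
  ext α
  simp [classicalGrad, h]

/-- A vanishing derivative makes the derivative of one order less constant, and that one is zero off
the compact support. A point off the support exists because the space is not compact. -/
theorem eq_zero_of_iteratedFDeriv_eq_zero {E : Type*} [NormedAddCommGroup E] [NormedSpace ℝ E]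
    [NoncompactSpace E] {u : E → ℝ} (hu : ContDiff ℝ ∞ u) (hc : HasCompactSupport u) (m : ℕ)
    (h : ∀ x, iteratedFDeriv ℝ m u x = 0) : ∀ x, u x = 0 := by
  induction m with
  | zero =>
    intro x
    have := DFunLike.congr_fun (h x) 0
    simpa using this
  | succ m ih =>
    refine ih fun x => ?_
    have hd : Differentiable ℝ (iteratedFDeriv ℝ m u) :=
      hu.differentiable_iteratedFDeriv (by exact_mod_cast ENat.natCast_lt_top m)
    have hconst := is_const_of_fderiv_eq_zero hd fun y => by
      rw [← norm_eq_zero, norm_fderiv_iteratedFDeriv, h y, norm_zero]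
    obtain ⟨z, hz⟩ := (ne_univ_iff_exists_notMem _).1 hc.isCompact.ne_univ
    rw [hconst x z]
    by_contra hne
    exact hz (support_iteratedFDeriv_subset m hne)

theorem exists_classicalGrad_ne_zero {n : ℕ} (hn : 1 ≤ n) (m : ℕ)
    {u : EuclideanSpace ℝ (Fin n) → ℝ} (hu : ContDiff ℝ ∞ u) (hc : HasCompactSupport u)
    (h0 : ∃ x, u x ≠ 0) : ∃ x, classicalGrad m u x ≠ 0 := by
  by_contra! hcon
  have : Nonempty (Fin n) := ⟨⟨0, hn⟩⟩
  have : NoncompactSpace (EuclideanSpace ℝ (Fin n)) := NormedSpace.noncompactSpace ℝ _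
  obtain ⟨x, hx⟩ := h0
  refine hx (eq_zero_of_iteratedFDeriv_eq_zero hu hc m (fun y => ?_) x)
  refine ContinuousMultilinearMap.toMultilinearMap_injective ?_
  refine Module.Basis.ext_multilinear (fun _ => (EuclideanSpace.basisFun (Fin n) ℝ).toBasis)
    fun α => ?_
  have := congrArg (fun v : EuclideanSpace ℝ (Fin m → Fin n) => v α) (hcon y)
  simpa [classicalGrad] using this

/-- Dilates of a single bump w behave, in all three norms, like multiples of indicators of sets of
measure comparable to 1 / t. -/
theorem inverseCondition_of_plainInequality {n j k : ℕ} (hn : 1 ≤ n) (hjk : j < k)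
    {A B C : ℝ≥0 → ℝ≥0} (hA : IsYoung A) (hB : IsYoung B) (hC : IsYoung C)
    (h : PlainInequality n j k A B C) : InverseCondition j k A B C := by
  obtain ⟨K, hK⟩ := h
  let b : ContDiffBump (0 : EuclideanSpace ℝ (Fin n)) := ⟨1 / 2, 1, by norm_num, by norm_num⟩
  set w : EuclideanSpace ℝ (Fin n) → ℝ := ⇑b with hwdef
  have hw : ContDiff ℝ ∞ w := b.contDiff
  have hwc : HasCompactSupport w := b.hasCompactSupport
  have hts : tsupport w = closedBall 0 1 := b.tsupport_eq
  have hne : ∃ x, w x ≠ 0 := ⟨0, by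
    have : b 0 = 1 := b.one_of_mem_closedBall (mem_closedBall_self (by norm_num [b]))
    rw [hwdef, this]; exact one_ne_zero⟩
  obtain ⟨x₀, hx₀⟩ := exists_classicalGrad_ne_zero hn j hw hwc hne
  have hgradc : ∀ m, HasCompactSupport (classicalGrad m w) := fun m =>
    HasCompactSupport.of_support_subset_isCompact hwc fun x hx => by
      by_contra hcon
      exact hx (classicalGrad_eq_zero_of_notMem_tsupport hcon)
  obtain ⟨W₀', hW₀'⟩ := hwc.exists_bound_of_continuous hw.continuous
  obtain ⟨Wk', hWk'⟩ := (hgradc k).exists_bound_of_continuous (continuous_classicalGrad hw)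
  set W₀ : ℝ≥0 := W₀'.toNNReal + 1 with hW₀def
  set Wk : ℝ≥0 := Wk'.toNNReal + 1 with hWkdef
  have hW₀pos : 0 < W₀ := by positivity
  have hWkpos : 0 < Wk := by positivity
  have hW₀ : ∀ x, ‖w x‖₊ ≤ W₀ := fun x =>
    (show ‖w x‖₊ ≤ W₀'.toNNReal from (hW₀' x).trans (Real.le_coe_toNNReal _)).trans le_self_add
  have hWk : ∀ x, ‖classicalGrad k w x‖₊ ≤ Wk := fun x =>
    (show ‖classicalGrad k w x‖₊ ≤ Wk'.toNNReal from (hWk' x).trans (Real.le_coe_toNNReal _)).trans le_self_add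
  -- Half the size of ∇ʲw at x₀, so that the open set O where |∇ʲw| > δ contains x₀ and has positive
  -- measure. The lower bound uses O, the upper bounds the whole unit ball; κ is the ratio of their
  -- measures.
  set δ : ℝ≥0 := ‖classicalGrad j w x₀‖₊ / 2 with hδ
  have hnpos : 0 < ‖classicalGrad j w x₀‖₊ := by simpa using hx₀
  have hδ0 : 0 < δ := by positivity
  set O : Set (EuclideanSpace ℝ (Fin n)) := {x | δ < ‖classicalGrad j w x‖₊} with hO
  have hOo : IsOpen O := isOpen_lt continuous_const (continuous_classicalGrad hw).nnnorm
  have hO0 : volume O ≠ 0 := (hOo.measure_pos volume ⟨x₀, NNReal.half_lt_self hnpos.ne'⟩).ne'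
  set V := volume (closedBall (0 : EuclideanSpace ℝ (Fin n)) 1) with hV
  have hV0 : V ≠ 0 := (measure_closedBall_pos volume _ one_pos).ne'
  have hVt : V ≠ ⊤ := measure_closedBall_lt_top.ne
  have hOV : volume O ≤ V := measure_mono fun x hx => by
    rw [← hts]
    by_contra hcon
    have hx' : δ < ‖classicalGrad j w x‖₊ := hx
    rw [classicalGrad_eq_zero_of_notMem_tsupport hcon, nnnorm_zero] at hx'
    exact not_lt_zero hx'
  have hOt : volume O ≠ ⊤ := ne_top_of_le_ne_top hVt hOV
  set v := V.toNNReal with hv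
  set o := (volume O).toNNReal with ho
  have hvV : V = v := (ENNReal.coe_toNNReal hVt).symm
  have hoO : volume O = o := (ENNReal.coe_toNNReal hOt).symm
  have hv0 : 0 < v := ENNReal.toNNReal_pos hV0 hVt
  have ho0 : 0 < o := ENNReal.toNNReal_pos hO0 hOt
  have hov : o ≤ v := ENNReal.toNNReal_mono hVt hOV
  set κ := v / o with hκ
  have hκ1 : 1 ≤ κ := (one_le_div ho0).2 hov
  have hκ0 : 0 < κ := zero_lt_one.trans_le hκ1
  set θ : ℝ := (j : ℝ) / k with hθ
  have hkR : (0 : ℝ) < k := by exact_mod_cast (by omega : 0 < k)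
  have hθ0 : 0 ≤ θ := by positivity
  have hθ1 : 0 ≤ 1 - θ := by
    rw [sub_nonneg, hθ, div_le_one hkR]
    exact_mod_cast hjk.le
  refine ⟨K * (Wk ^ θ * W₀ ^ (1 - θ)) * κ / δ, fun t ht => ?_⟩
  -- With this ρ the dilated unit ball has measure exactly 1 / t and the dilate of O has measure 1 /
  -- (κ t).
  obtain ⟨ρ, hρ0, hρ⟩ : ∃ ρ : ℝ≥0, 0 < ρ ∧ ρ ^ n * (v * t) = 1 := by
    refine ⟨((v * t)⁻¹) ^ ((1 : ℝ) / n), NNReal.rpow_pos (by positivity), ?_⟩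
    rw [← NNReal.rpow_natCast, ← NNReal.rpow_mul, one_div,
      inv_mul_cancel₀ (by exact_mod_cast (by omega : n ≠ 0)), NNReal.rpow_one]
    exact inv_mul_cancel₀ (by positivity)
  have hρR : (0 : ℝ) < ρ := by exact_mod_cast hρ0
  set u : EuclideanSpace ℝ (Fin n) → ℝ := fun x => w ((ρ : ℝ)⁻¹ • x) with hu
  have huS : ContDiff ℝ ∞ u := by
    have : ContDiff ℝ ∞ fun x : EuclideanSpace ℝ (Fin n) => (ρ : ℝ)⁻¹ • x := by fun_prop
    exact hw.comp this
  have hvol : ∀ S : Set (EuclideanSpace ℝ (Fin n)),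
      volume ((fun x => (ρ : ℝ)⁻¹ • x) ⁻¹' S) = ((ρ ^ n : ℝ≥0) : ℝ≥0∞) * volume S := fun S => by
    rw [Measure.addHaar_preimage_smul _ (inv_ne_zero hρR.ne'), finrank_euclideanSpace_fin,
      inv_pow, inv_inv, abs_of_pos (by positivity)]
    congr 1
    rw [← NNReal.coe_pow, ENNReal.ofReal_coe_nnreal]
  have hmeas : Measurable fun x : EuclideanSpace ℝ (Fin n) => (ρ : ℝ)⁻¹ • x :=
    measurable_const_smul _
  have hnorm : ∀ m x, ‖classicalGrad m u x‖ₑ =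
      ((ρ⁻¹ ^ m * ‖classicalGrad m w ((ρ : ℝ)⁻¹ • x)‖₊ : ℝ≥0) : ℝ≥0∞) := fun m x => by
    rw [hu, classicalGrad_comp_smul hw, enorm_eq_nnnorm, nnnorm_smul, nnnorm_pow, nnnorm_inv]
    simp
  set S := (fun x : EuclideanSpace ℝ (Fin n) => (ρ : ℝ)⁻¹ • x) ⁻¹' closedBall 0 1 with hS
  have hSm : MeasurableSet S := hmeas measurableSet_closedBall
  have hSt : volume S * t ≤ 1 := by
    rw [hS, hvol, ← hV, hvV, mul_assoc, ← ENNReal.coe_mul, ← ENNReal.coe_mul, hρ, ENNReal.coe_one]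
  have hup : luxemburg C volume (fun x => ‖u x‖ₑ) ≤ (W₀ / inverse C t : ℝ≥0) := by
    refine hC.luxemburg_le_div_inverse hSm hW₀pos ht hSt (fun x _ => ?_) fun x hx => ?_
    · exact ENNReal.coe_le_coe.2 (hW₀ _)
    · have : w ((ρ : ℝ)⁻¹ • x) = 0 :=
        image_eq_zero_of_notMem_tsupport fun hcon => hx (hts.subset hcon)
      simp [hu, this]
  have hgk : luxemburg B volume (fun x => ‖classicalGrad k u x‖ₑ) ≤
      (ρ⁻¹ ^ k * Wk / inverse B t : ℝ≥0) := by
    refine hB.luxemburg_le_div_inverse hSm (by positivity) ht hSt (fun x _ => ?_) fun x hx => ?_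
    · rw [hnorm]
      exact ENNReal.coe_le_coe.2 (by gcongr; exact hWk _)
    · rw [hnorm, classicalGrad_eq_zero_of_notMem_tsupport fun hcon => hx (hts.subset hcon)]
      simp
  have hgj : ((ρ⁻¹ ^ j * δ / inverse A (κ * t) : ℝ≥0) : ℝ≥0∞) ≤
      luxemburg A volume (fun x => ‖classicalGrad j u x‖ₑ) := by
    refine hA.div_inverse_le_luxemburg (S := (fun x => (ρ : ℝ)⁻¹ • x) ⁻¹' O)
      (hmeas hOo.measurableSet) (by positivity) ?_ fun x hx => ?_
    · rw [hvol, hoO, ← ENNReal.coe_mul, ← ENNReal.coe_mul]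
      have : ρ ^ n * o * (κ * t) = 1 := by
        rw [← hρ, hκ]
        field_simp
      rw [this, ENNReal.coe_one]
    · rw [hnorm]
      refine ENNReal.coe_le_coe.2 ?_
      gcongr
      exact le_of_lt hx
  have hmain := hK u ⟨huS.continuous.locallyIntegrable,
    fun m _ => ⟨_, hasWeakGrad_classicalGrad m huS⟩⟩ _ _ (hasWeakGrad_classicalGrad j huS)
    (hasWeakGrad_classicalGrad k huS) (Or.inr (ne_top_of_le_ne_top ENNReal.coe_ne_top hup))
  have hA0 := hA.inverse_pos ht
  have hB0 := hB.inverse_pos ht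
  have hC0 := hC.inverse_pos ht
  have hfin : ρ⁻¹ ^ j * δ / inverse A (κ * t) ≤
      K * ((ρ⁻¹ ^ k * Wk / inverse B t) ^ θ * (W₀ / inverse C t) ^ (1 - θ)) := by
    have h1 := hgj.trans hmain
    have h2 : (K : ℝ≥0∞) * (luxemburg B volume (fun x => ‖classicalGrad k u x‖ₑ) ^ θ *
        luxemburg C volume (fun x => ‖u x‖ₑ) ^ (1 - θ)) ≤
        ((K * ((ρ⁻¹ ^ k * Wk / inverse B t) ^ θ * (W₀ / inverse C t) ^ (1 - θ)) : ℝ≥0) : ℝ≥0∞) := by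
      rw [ENNReal.coe_mul, ENNReal.coe_mul, ENNReal.coe_rpow_of_nonneg _ hθ0,
        ENNReal.coe_rpow_of_nonneg _ hθ1]
      gcongr
    exact ENNReal.coe_le_coe.1 (h1.trans h2)
  -- Homogeneity: both sides carry the factor ρ⁻ʲ, which cancels and leaves a relation in t alone.
  -- The argument κ t of the inverse of A is then reduced to t by concavity, at the cost of a factor
  -- κ.
  have hρθ : (ρ⁻¹ ^ k) ^ θ = ρ⁻¹ ^ j := by
    rw [← NNReal.rpow_natCast, ← NNReal.rpow_mul, hθ, mul_div_cancel₀ _ hkR.ne',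
      NNReal.rpow_natCast]
  rw [NNReal.div_rpow, NNReal.mul_rpow, NNReal.div_rpow, hρθ] at hfin
  have hAκ := hA.inverse_mul_le hκ1 t
  have hAκ0 : 0 < inverse A (κ * t) := hA.inverse_pos (by positivity)
  have hbθ := NNReal.rpow_pos (p := θ) hB0
  have hcθ := NNReal.rpow_pos (p := 1 - θ) hC0
  set bt := inverse B t ^ θ
  set ct := inverse C t ^ (1 - θ)
  set wt := Wk ^ θ
  set w0 := W₀ ^ (1 - θ)
  have hρj : 0 < ρ⁻¹ ^ j := by positivity
  set R := ρ⁻¹ ^ j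
  have hf2 : δ / inverse A (κ * t) ≤ K * (wt * w0) / (bt * ct) := by
    have e1 : R * δ / inverse A (κ * t) = R * (δ / inverse A (κ * t)) := mul_div_assoc _ _ _
    have e2 : K * (R * wt / bt * (w0 / ct)) = R * (K * (wt * w0) / (bt * ct)) := by
      field_simp
    rw [e1, e2] at hfin
    exact le_of_mul_le_mul_left hfin hρj
  rw [div_le_div_iff₀ hAκ0 (by positivity)] at hf2
  have hf3 : δ * (bt * ct) ≤ K * (wt * w0) * (κ * inverse A t) :=
    hf2.trans (by gcongr)
  calc bt * ct = δ * (bt * ct) / δ := by rw [mul_div_cancel_left₀ _ hδ0.ne']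
    _ ≤ K * (wt * w0) * (κ * inverse A t) / δ := by gcongr
    _ = _ := by ring

end GNOrlicz

end

theorem corollary1p4 (n j k : ℕ) (hn : 1 ≤ n) (hj : 1 ≤ j) (hjk : j < k)
    (A B C : ℝ≥0 → ℝ≥0) (hA : GNOrlicz.IsYoung A) (hB : GNOrlicz.IsYoung B)
    (hC : GNOrlicz.IsYoung C) :
    (GNOrlicz.InverseCondition j k A B C → GNOrlicz.MaximalInequality n j k A B C) ∧
    (GNOrlicz.InverseCondition j k A B C →
      GNOrlicz.upperBoydIndex B < 1 → GNOrlicz.upperBoydIndex C < 1 →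
      GNOrlicz.PlainInequality n j k A B C) ∧
    (¬ GNOrlicz.InverseCondition j k A B C → ¬ GNOrlicz.PlainInequality n j k A B C) := by
  exact ⟨GNOrlicz.maximalInequality_of_inverseCondition hn hj hjk hA hB hC,
    GNOrlicz.plainInequality_of_inverseCondition hn hj hjk hA hB hC,
    mt (GNOrlicz.inverseCondition_of_plainInequality hn hjk hA hB hC)⟩
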